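/- Let $T:(0,1]\to(0,1]$, $Tx=2x-\lceil 2x\rceil+1$, be the doubling map and let $\varphi:(0,1]\to\mathbb{R}$ be the Saint-Petersburg potential, $\varphi(x)=2^n$ for $x\in(2^{-n-1},2^{-n}]$, $n\ge 0$. Put $S_n(x)=\varphi(x)+\varphi(Tx)+\cdots+\varphi(T^{n-1}x)$ and, for $\alpha\ge 1$, $E(\alpha)=\{x\in(0,1]: \lim_{n\to\infty}\frac1n S_n(x)=\alpha\}$. For $t\in\mathbb{R}$ and $q>0$ put $$P(t,q)=\log\sum_{j=1}^{\infty}2^{-tj-q(2^j-1)},$$ where the series converges. For each $q>0$ there is a unique $t(q)\in\mathbb{R}$ with $P(t(q),q)=0$, and for every $\alpha\ge 1$ the Hausdorff dimension of $E(\alpha)$ is $$\dim_H E(\alpha)=\inf_{q>0}\{t(q)+q\alpha\}.$$ Moreover $\dim_H E(1)=0$, and the function $\alpha\mapsto\dim_H E(\alpha)$ is real-analytic on $(1,\infty)$, strictly increasing and concave on $[1,\infty)$, and tends to $1$ as $\alpha\to\infty$. -/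

import Mathlib

open Set Filter Topology

/-- The doubling map `T x = 2x - ⌈2x⌉ + 1`, a self-map of `(0,1]`
(written as a map on `ℝ`; only its restriction to `(0,1]` matters). -/
noncomputable def doublingMap (x : ℝ) : ℝ := 2 * x - (⌈2 * x⌉ : ℝ) + 1

theorem doublingMap_mapsTo : MapsTo doublingMap (Ioc 0 1) (Ioc 0 1) := by
  intro x _
  have h1 := Int.ceil_lt_add_one (2 * x)
  have h2 := Int.le_ceil (2 * x)
  constructor <;> unfold doublingMap <;> linarith

/-- The Saint-Petersburg potential: `φ x = 2 ^ n` for `x ∈ (2^{-n-1}, 2^{-n}]`, `n ≥ 0`.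
For `x ∈ (0,1]` the set below has exactly one element. -/
noncomputable def saintPetersburg (x : ℝ) : ℝ :=
  2 ^ sInf {n : ℕ | x ∈ Ioc ((1 / 2 : ℝ) ^ (n + 1)) ((1 / 2 : ℝ) ^ n)}

theorem saintPetersburg_eq {x : ℝ} {n : ℕ}
    (hx : x ∈ Ioc ((1 / 2 : ℝ) ^ (n + 1)) ((1 / 2 : ℝ) ^ n)) :
    saintPetersburg x = 2 ^ n := by
  have h : {m : ℕ | x ∈ Ioc ((1 / 2 : ℝ) ^ (m + 1)) ((1 / 2 : ℝ) ^ m)} = {n} := by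
    ext m
    rw [mem_ofPred_eq, mem_singleton_iff]
    constructor
    · intro hm
      have h1 : m < n + 1 := by
        have := hx.1.trans_le hm.2
        exact (pow_lt_pow_iff_right_of_lt_one₀ (by norm_num) (by norm_num)).1 this
      have h2 : n < m + 1 := by
        have := hm.1.trans_le hx.2
        exact (pow_lt_pow_iff_right_of_lt_one₀ (by norm_num) (by norm_num)).1 this
      omega
    · rintro rfl
      exact hx
  rw [saintPetersburg, h, csInf_singleton]

/-- The level set `E(α) = {x ∈ (0,1] : S_n(x) / n → α}`, where
`S_n(x) = φ(x) + φ(T x) + ⋯ + φ(T^{n-1} x)`. -/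
def birkhoffLevelSet (α : ℝ) : Set ℝ :=
  {x ∈ Ioc (0 : ℝ) 1 |
    Tendsto (fun n : ℕ => birkhoffSum doublingMap saintPetersburg n x / n) atTop (𝓝 α)}

/-- The Birkhoff spectrum `α ↦ dim_H E(α)`, as a real number. -/
noncomputable def birkhoffSpectrum (α : ℝ) : ℝ := (dimH (birkhoffLevelSet α)).toReal

/-- The term of index `j + 1` in the series defining the pressure:
`2 ^ (-t (j+1) - q (2^{j+1} - 1))`. -/
noncomputable def pressureTerm (t q : ℝ) (j : ℕ) : ℝ :=
  (2 : ℝ) ^ (-t * ((j : ℝ) + 1) - q * ((2 : ℝ) ^ (j + 1) - 1))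

/-- The pressure `P(t,q) = log ∑_{j ≥ 1} 2 ^ (-t j - q (2^j - 1))`. -/
noncomputable def pressure (t q : ℝ) : ℝ := Real.log (∑' j : ℕ, pressureTerm t q j)

/-! Each point of `(0,1]` has a unique binary expansion with infinitely many ones, hence splits
uniquely into blocks `0⋯01`. A block of length `j` carries the potential `2^(j-1) + ⋯ + 1 = 2^j -
1`. Inducing on blocks thus turns the dynamics into a full shift on countably many symbols, with
length `j` and weight `2^j - 1` as the only data. If `(t, q)` is a zero of the pressure, the numbers
`p_j = 2^(-t j - q (2^j - 1))` are probabilities, and a cylinder of total length `L` and total sum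
`S` has product mass `2^(-(t L + q S))`, while its diameter is at most `2^(-L)`.

Upper bound: where `S ≤ β L`, this mass dominates `diam^(t + q β)`, so the cylinders of `n` blocks
give covers of bounded cost; let `β` decrease to `α` (`dimH_birkhoffLevelSet_le`). Lower bound: draw
independent blocks with law `p`. By the strong law, `S / L` tends to `B / A`, the ratio of the
means, and the mass distribution principle gives dimension at least `t + q B / A`
(`le_dimH_birkhoffLevelSet`). The bounds meet when `B = α A`, formally the critical equation of `q ↦
t(q) + q α`. Along the curve `(t(q), q)` the ratio `B / A` approaches `1` as `q → ∞` and is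
unbounded as `q → 0`, so every `α > 1` has such a `q` (`exists_meanSum_eq`); for `α = 1` one uses
`t(q) + q → 0`.

Monotonicity, concavity and the limit follow from the resulting infimum of affine functions. For
analyticity, the critical pair solves `(∑ p, B / A) = (1, α)`; this system is analytic, and a
variance-type sum of squares makes its derivative injective there (`eq_zero_of_fderiv_eq_zero`), so
the inverse function theorem applies. -/

/-! ### Block decomposition and Birkhoff sums at block times -/

/-- The number of leading zeros in the (non-terminating) binary expansion of `x ∈ (0,1]`. -/
noncomputable def leadingZeros (x : ℝ) : ℕ :=
  sInf {n : ℕ | x ∈ Ioc ((1 / 2 : ℝ) ^ (n + 1)) ((1 / 2 : ℝ) ^ n)}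

/-- The first-return map of the doubling map, deleting the first block `0⋯01` of the expansion. -/
noncomputable def inducedMap (x : ℝ) : ℝ := 2 ^ (leadingZeros x + 1) * x - 1

/-- The sequence of numbers of zeros in the successive blocks `0⋯01` of the expansion of `x`. -/
noncomputable def itinerary (x : ℝ) (k : ℕ) : ℕ := leadingZeros (inducedMap^[k] x)

/-- Total length of the first `k` blocks of a sequence. -/
def blockLength (a : ℕ → ℕ) (k : ℕ) : ℕ := ∑ i ∈ Finset.range k, (a i + 1)

/-- Sum of the Saint-Petersburg potential over the first `k` blocks of a sequence. -/
noncomputable def blockSum (a : ℕ → ℕ) (k : ℕ) : ℝ :=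
  ∑ i ∈ Finset.range k, ((2 : ℝ) ^ (a i + 1) - 1)

theorem leadingZeros_spec {x : ℝ} (hx : x ∈ Ioc (0 : ℝ) 1) :
    x ∈ Ioc ((1 / 2 : ℝ) ^ (leadingZeros x + 1)) ((1 / 2 : ℝ) ^ leadingZeros x) := by
  obtain ⟨n, h1, h2⟩ := exists_nat_pow_near_of_lt_one hx.1 hx.2
    (by norm_num : (0 : ℝ) < 1 / 2) (by norm_num)
  exact Nat.sInf_mem (s := {n : ℕ | x ∈ Ioc ((1 / 2 : ℝ) ^ (n + 1)) ((1 / 2 : ℝ) ^ n)})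
    ⟨n, h1, h2⟩

theorem leadingZeros_eq {x : ℝ} {n : ℕ}
    (hx : x ∈ Ioc ((1 / 2 : ℝ) ^ (n + 1)) ((1 / 2 : ℝ) ^ n)) : leadingZeros x = n := by
  have h : (2 : ℝ) ^ leadingZeros x = 2 ^ n := saintPetersburg_eq hx
  exact pow_right_injective₀ (by norm_num) (by norm_num) h

theorem inducedMap_mem {x : ℝ} (hx : x ∈ Ioc (0 : ℝ) 1) : inducedMap x ∈ Ioc (0 : ℝ) 1 := by
  obtain ⟨h1, h2⟩ := leadingZeros_spec hx
  have h3 : (0 : ℝ) < 2 ^ (leadingZeros x + 1) := by positivity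
  rw [one_div, inv_pow] at h1 h2
  rw [inv_lt_iff_one_lt_mul₀ h3] at h1
  rw [le_inv_comm₀ hx.1 (by positivity), ← one_div, le_div_iff₀ hx.1] at h2
  unfold inducedMap
  constructor
  · linarith
  · rw [pow_succ]; linarith

theorem itinerary_inducedMap (x : ℝ) (k : ℕ) :
    itinerary (inducedMap x) k = itinerary x (k + 1) := rfl

theorem blockLength_succ' (a : ℕ → ℕ) (k : ℕ) :
    blockLength a (k + 1) = blockLength (fun i => a (i + 1)) k + (a 0 + 1) :=
  Finset.sum_range_succ' _ _

theorem blockSum_succ' (a : ℕ → ℕ) (k : ℕ) :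
    blockSum a (k + 1) = blockSum (fun i => a (i + 1)) k + (2 ^ (a 0 + 1) - 1) :=
  Finset.sum_range_succ' _ _

theorem blockLength_succ (a : ℕ → ℕ) (k : ℕ) :
    blockLength a (k + 1) = blockLength a k + (a k + 1) :=
  Finset.sum_range_succ _ _

theorem blockLength_congr {a b : ℕ → ℕ} {k : ℕ} (h : ∀ i < k, a i = b i) :
    blockLength a k = blockLength b k :=
  Finset.sum_congr rfl fun i hi => by rw [h i (Finset.mem_range.1 hi)]

theorem blockLength_strictMono (a : ℕ → ℕ) : StrictMono (blockLength a) :=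
  strictMono_nat_of_lt_succ fun k => by rw [blockLength_succ]; omega

/-- Until the leading one is reached, `doublingMap` only doubles, so the potential runs through
`2^n, …, 2, 1`, a geometric sum. -/
theorem doublingMap_block {n : ℕ} {x : ℝ}
    (hx : x ∈ Ioc ((1 / 2 : ℝ) ^ (n + 1)) ((1 / 2 : ℝ) ^ n)) :
    doublingMap^[n + 1] x = 2 ^ (n + 1) * x - 1 ∧
      birkhoffSum doublingMap saintPetersburg (n + 1) x = 2 ^ (n + 1) - 1 := by
  induction n generalizing x with
  | zero =>
    have hc : ⌈2 * x⌉ = 2 := by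
      rw [Int.ceil_eq_iff]
      have h1 := hx.1
      have h2 := hx.2
      norm_num at h1 h2 ⊢
      constructor <;> linarith
    have hs := saintPetersburg_eq hx
    constructor
    · simp [doublingMap, hc]; ring
    · simp [birkhoffSum, hs]; norm_num
  | succ n ih =>
    have h1 := hx.1
    have h2 := hx.2
    have hp : (0 : ℝ) < (1 / 2) ^ (n + 1) := by positivity
    have hq : (1 / 2 : ℝ) ^ n ≤ 1 := pow_le_one₀ (by norm_num) (by norm_num)
    have e1 : (1 / 2 : ℝ) ^ (n + 1 + 1) = (1 / 2) ^ (n + 1) / 2 := by ring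
    have e2 : (1 / 2 : ℝ) ^ (n + 1) = (1 / 2) ^ n / 2 := by ring
    have hc : ⌈2 * x⌉ = 1 := by
      rw [Int.ceil_eq_iff]
      push_cast
      constructor <;> linarith
    have hT : doublingMap x = 2 * x := by simp [doublingMap, hc]
    have hm : 2 * x ∈ Ioc ((1 / 2 : ℝ) ^ (n + 1)) ((1 / 2 : ℝ) ^ n) := by
      constructor <;> linarith
    obtain ⟨i1, i2⟩ := ih hm
    constructor
    · rw [Function.iterate_succ_apply, hT, i1]; ring
    · rw [birkhoffSum_succ', hT, i2, saintPetersburg_eq hx]; ring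

theorem iterate_doublingMap_leadingZeros {x : ℝ} (hx : x ∈ Ioc (0 : ℝ) 1) :
    doublingMap^[leadingZeros x + 1] x = inducedMap x :=
  (doublingMap_block (leadingZeros_spec hx)).1

theorem birkhoffSum_blockLength {x : ℝ} (hx : x ∈ Ioc (0 : ℝ) 1) (k : ℕ) :
    birkhoffSum doublingMap saintPetersburg (blockLength (itinerary x) k) x =
      blockSum (itinerary x) k := by
  induction k generalizing x with
  | zero => simp [blockLength, blockSum]
  | succ k ih =>
    have h0 : itinerary x 0 = leadingZeros x := rfl
    have := ih (inducedMap_mem hx)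
    rw [blockLength_succ', blockSum_succ', h0, add_comm, birkhoffSum_add,
      iterate_doublingMap_leadingZeros hx, (doublingMap_block (leadingZeros_spec hx)).2, add_comm]
    congr 1

theorem birkhoffSum_saintPetersburg_mono (x : ℝ) :
    Monotone fun n => birkhoffSum doublingMap saintPetersburg n x :=
  monotone_nat_of_le_succ fun n => by
    rw [birkhoffSum_succ]
    have : 0 ≤ saintPetersburg (doublingMap^[n] x) := by unfold saintPetersburg; positivity
    linarith

/-- Block times form a subsequence of all times; the upper bound needs nothing more. -/
theorem tendsto_blockSum_div_of_mem {α x : ℝ} (hx : x ∈ birkhoffLevelSet α) :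
    Tendsto (fun k => blockSum (itinerary x) k / blockLength (itinerary x) k) atTop (𝓝 α) := by
  refine (hx.2.comp (blockLength_strictMono (itinerary x)).tendsto_atTop).congr fun k => ?_
  simp [birkhoffSum_blockLength hx.1]

/-- The index of the block containing position `n`. -/
noncomputable def blockIndex (a : ℕ → ℕ) (n : ℕ) : ℕ :=
  -- The search bound `n` loses nothing: every block has length at least one, so `k ≤ blockLength a
  -- k`.
  Nat.findGreatest (fun k => blockLength a k ≤ n) n

theorem blockLength_blockIndex_le (a : ℕ → ℕ) (n : ℕ) : blockLength a (blockIndex a n) ≤ n :=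
  Nat.findGreatest_spec (P := fun k => blockLength a k ≤ n) (Nat.zero_le n) (by simp [blockLength])

theorem le_blockIndex {a : ℕ → ℕ} {n k : ℕ} (h : blockLength a k ≤ n) : k ≤ blockIndex a n :=
  Nat.le_findGreatest (((blockLength_strictMono a).id_le k).trans h) h

theorem lt_blockLength_blockIndex_succ (a : ℕ → ℕ) (n : ℕ) :
    n < blockLength a (blockIndex a n + 1) := by
  by_contra! h
  have := le_blockIndex h
  omega

theorem tendsto_blockIndex (a : ℕ → ℕ) : Tendsto (blockIndex a) atTop atTop :=
  tendsto_atTop.2 fun k => (eventually_ge_atTop (blockLength a k)).mono fun _ => le_blockIndex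

/-- Serves to compare a sum over `k` blocks with a length of `k + 1` blocks, or the reverse:
convergent averages make a single block negligible. -/
theorem tendsto_div_shift {u v : ℕ → ℝ} {A B : ℝ} (hA : A ≠ 0)
    (hu : Tendsto (fun k : ℕ => u k / k) atTop (𝓝 B))
    (hv : Tendsto (fun k : ℕ => v k / k) atTop (𝓝 A)) (i j : ℕ) :
    Tendsto (fun k => u (k + i) / v (k + j)) atTop (𝓝 (B / A)) := by
  have h1 : ∀ m : ℕ, Tendsto (fun k : ℕ => ((k + m : ℕ) : ℝ) / k) atTop (𝓝 1) := fun m => by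
    have : Tendsto (fun k : ℕ => 1 + (m : ℝ) / k) atTop (𝓝 (1 + 0)) :=
      tendsto_const_nhds.add (tendsto_const_div_atTop_nhds_zero_nat _)
    rw [add_zero] at this
    refine this.congr' ?_
    filter_upwards [eventually_gt_atTop 0] with k hk
    have : (k : ℝ) ≠ 0 := by positivity
    push_cast; field_simp
  have h2 := (((tendsto_add_atTop_iff_nat i).2 hu).mul (h1 i)).div
    (((tendsto_add_atTop_iff_nat j).2 hv).mul (h1 j)) (by simpa using hA)
  simp only [mul_one] at h2
  refine h2.congr' ?_
  filter_upwards [eventually_gt_atTop 0] with k hk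
  have a1 : (k : ℝ) ≠ 0 := by positivity
  have a2 : ((k + i : ℕ) : ℝ) ≠ 0 := by positivity
  have a3 : ((k + j : ℕ) : ℝ) ≠ 0 := by positivity
  simp only [Pi.div_apply]
  rw [div_mul_div_cancel₀ a2, div_mul_div_cancel₀ a3, div_div_div_cancel_right₀ a1]

/-- The potential is nonnegative, so if time `n` falls in the block after the first `k`, then `S_n /
n` lies between `blockSum k / blockLength (k+1)` and `blockSum (k+1) / blockLength k`. Limits of the
per-block averages are assumed, rather than of their ratio, so that both bounds have the same limit.
-/
theorem mem_birkhoffLevelSet {x A B : ℝ} (hx : x ∈ Ioc (0 : ℝ) 1) (hA : A ≠ 0)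
    (hB : Tendsto (fun k : ℕ => blockSum (itinerary x) k / k) atTop (𝓝 B))
    (hL : Tendsto (fun k : ℕ => (blockLength (itinerary x) k : ℝ) / k) atTop (𝓝 A)) :
    x ∈ birkhoffLevelSet (B / A) := by
  refine ⟨hx, ?_⟩
  have hk := tendsto_blockIndex (itinerary x)
  refine tendsto_of_tendsto_of_tendsto_of_le_of_le' ((tendsto_div_shift hA hB hL 0 1).comp hk)
    ((tendsto_div_shift hA hB hL 1 0).comp hk) ?_ ?_
  · filter_upwards [eventually_gt_atTop 0] with n hn
    have h1 : (0 : ℝ) < n := by positivity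
    have h2 : (n : ℝ) ≤ blockLength (itinerary x) (blockIndex (itinerary x) n + 1) := by
      exact_mod_cast (lt_blockLength_blockIndex_succ _ n).le
    have h3 := birkhoffSum_saintPetersburg_mono x (blockLength_blockIndex_le (itinerary x) n)
    simp only [birkhoffSum_blockLength hx] at h3
    have h4 : 0 ≤ blockSum (itinerary x) (blockIndex (itinerary x) n) :=
      Finset.sum_nonneg fun i _ => sub_nonneg.2 (one_le_pow₀ (by norm_num))
    simp only [Function.comp, add_zero]
    exact div_le_div₀ (h4.trans h3) h3 h1 h2
  · filter_upwards [eventually_ge_atTop (blockLength (itinerary x) 1)] with n hn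
    have h0 := le_blockIndex hn
    have h1 : (0 : ℝ) < blockLength (itinerary x) (blockIndex (itinerary x) n) := by
      exact_mod_cast h0.trans ((blockLength_strictMono (itinerary x)).id_le _)
    have h2 : (blockLength (itinerary x) (blockIndex (itinerary x) n) : ℝ) ≤ n := by
      exact_mod_cast blockLength_blockIndex_le _ n
    have h3 := birkhoffSum_saintPetersburg_mono x
      (lt_blockLength_blockIndex_succ (itinerary x) n).le
    simp only [birkhoffSum_blockLength hx] at h3
    have h4 : 0 ≤ blockSum (itinerary x) (blockIndex (itinerary x) n + 1) :=
      Finset.sum_nonneg fun i _ => sub_nonneg.2 (one_le_pow₀ (by norm_num))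
    simp only [Function.comp, add_zero]
    gcongr

/-! ### Block cylinders and dyadic intervals -/

/-- Two points whose first `k` blocks agree are `2 ^ (-N)`-close, `N` the length of the blocks. -/
theorem abs_sub_le_of_itinerary_eq {x y : ℝ} (hx : x ∈ Ioc (0 : ℝ) 1) (hy : y ∈ Ioc (0 : ℝ) 1)
    {k : ℕ} (h : ∀ i < k, itinerary x i = itinerary y i) :
    |x - y| ≤ (1 / 2) ^ blockLength (itinerary x) k := by
  induction k generalizing x y with
  | zero =>
    simp only [blockLength, Finset.range_zero, Finset.sum_empty, pow_zero, abs_le]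
    constructor <;> linarith [hx.1, hx.2, hy.1, hy.2]
  | succ k ih =>
    have h0 : leadingZeros x = leadingZeros y := h 0 (Nat.succ_pos k)
    have h1 := ih (inducedMap_mem hx) (inducedMap_mem hy) fun i hi => h (i + 1) (by omega)
    have h2 : inducedMap x - inducedMap y = 2 ^ (leadingZeros x + 1) * (x - y) := by
      unfold inducedMap; rw [← h0]; ring
    have e : itinerary x 0 = leadingZeros x := rfl
    rw [h2, abs_mul, abs_of_pos (by positivity), ← le_div_iff₀' (by positivity)] at h1
    rw [blockLength_succ', e, pow_add]
    refine h1.trans_eq ?_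
    rw [one_div_pow 2 (leadingZeros x + 1), mul_one_div]
    rfl

/-- The dyadic interval of order `N` around `x` is contained in its block cylinder of length `N`. -/
theorem itinerary_eq_of_ceil_eq {x y : ℝ} (hx : x ∈ Ioc (0 : ℝ) 1) (hy : y ∈ Ioc (0 : ℝ) 1)
    {k : ℕ} (h : ⌈2 ^ blockLength (itinerary x) k * x⌉ = ⌈2 ^ blockLength (itinerary x) k * y⌉) :
    ∀ i < k, itinerary x i = itinerary y i := by
  induction k generalizing x y with
  | zero => intro i hi; omega
  | succ k ih =>
    set N := blockLength (itinerary (inducedMap x)) k with hN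
    have hl : blockLength (itinerary x) (k + 1) = N + (leadingZeros x + 1) := blockLength_succ' _ _
    rw [hl] at h
    -- Equal ceilings mean that exactly the same integers lie strictly below both scaled points;
    -- membership in the first block's interval is such a comparison, with `2^N` and `2^(N+1)`.
    have key : ∀ m : ℤ, (m : ℝ) < 2 ^ (N + (leadingZeros x + 1)) * x ↔
        (m : ℝ) < 2 ^ (N + (leadingZeros x + 1)) * y := fun m => by
      rw [← Int.lt_ceil, ← Int.lt_ceil, h]
    have hx' := leadingZeros_spec hx
    have hd : ∀ z : ℝ, z ∈ Ioc ((1 / 2 : ℝ) ^ (leadingZeros x + 1)) ((1 / 2 : ℝ) ^ leadingZeros x) ↔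
        ((2 ^ N : ℤ) : ℝ) < 2 ^ (N + (leadingZeros x + 1)) * z ∧
          ¬ ((2 ^ (N + 1) : ℤ) : ℝ) < 2 ^ (N + (leadingZeros x + 1)) * z := fun z => by
      have e1 : ((2 ^ N : ℤ) : ℝ) =
          2 ^ (N + (leadingZeros x + 1)) * (1 / 2) ^ (leadingZeros x + 1) := by
        push_cast; rw [pow_add, mul_assoc, ← mul_pow]; norm_num
      have e2 : ((2 ^ (N + 1) : ℤ) : ℝ) =
          2 ^ (N + (leadingZeros x + 1)) * (1 / 2) ^ (leadingZeros x) := by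
        push_cast
        rw [show N + (leadingZeros x + 1) = N + 1 + leadingZeros x by ring, pow_add _ (N + 1),
          mul_assoc, ← mul_pow]
        norm_num
      rw [e1, e2, mul_lt_mul_iff_right₀ (by positivity), not_lt,
        mul_le_mul_iff_right₀ (by positivity), mem_Ioc]
    have h0 : leadingZeros y = leadingZeros x := by
      apply leadingZeros_eq
      rw [hd, ← key, ← key, ← hd]
      exact hx'
    have hs : ∀ z : ℝ, leadingZeros z = leadingZeros x →
        2 ^ N * inducedMap z = 2 ^ (N + (leadingZeros x + 1)) * z - ((2 ^ N : ℤ) : ℝ) := by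
      intro z hz
      unfold inducedMap
      rw [hz]; push_cast; ring
    have h1 : ⌈2 ^ N * inducedMap x⌉ = ⌈2 ^ N * inducedMap y⌉ := by
      rw [hs x rfl, hs y h0, Int.ceil_sub_intCast, Int.ceil_sub_intCast, h]
    intro i hi
    rcases i with _ | i
    · exact h0.symm
    · exact ih (inducedMap_mem hx) (inducedMap_mem hy) h1 i (by omega)

/-! ### Gibbs weights and the upper bound for the dimension -/

theorem pressureTerm_pos (t q : ℝ) (j : ℕ) : 0 < pressureTerm t q j := by
  unfold pressureTerm; positivity

theorem prod_pressureTerm (t q : ℝ) (a : ℕ → ℕ) (k : ℕ) :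
    ∏ i ∈ Finset.range k, pressureTerm t q (a i) =
      (2 : ℝ) ^ (-(t * blockLength a k + q * blockSum a k)) := by
  induction k with
  | zero => simp [blockLength, blockSum]
  | succ k ih =>
    rw [Finset.prod_range_succ, ih, pressureTerm, ← Real.rpow_add two_pos, blockLength_succ,
      blockSum, blockSum, Finset.sum_range_succ]
    congr 1
    push_cast
    ring

/-- The Gibbs distribution `j ↦ 2 ^ (-t j - q (2 ^ j - 1))` on block lengths. -/
noncomputable def blockPMF (t q : ℝ) (h : HasSum (pressureTerm t q) 1) : PMF ℕ :=
  ⟨fun j => ENNReal.ofReal (pressureTerm t q j), by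
    rw [← ENNReal.ofReal_one, ← h.tsum_eq,
      ENNReal.ofReal_tsum_of_nonneg (fun j => (pressureTerm_pos t q j).le) h.summable]
    exact ENNReal.summable.hasSum⟩

theorem blockPMF_apply (t q : ℝ) (h : HasSum (pressureTerm t q) 1) (j : ℕ) :
    blockPMF t q h j = ENNReal.ofReal (pressureTerm t q j) := rfl

/-- The sum over all words of length `n` is the total mass of a finite product of probability
measures. -/
theorem tsum_prod_pressureTerm {t q : ℝ} (h : HasSum (pressureTerm t q) 1) (n : ℕ) :
    ∑' a : Fin n → ℕ, ∏ i, ENNReal.ofReal (pressureTerm t q (a i)) = 1 := by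
  have := MeasureTheory.Measure.tsum_indicator_apply_singleton
    (MeasureTheory.Measure.pi fun _ : Fin n => (blockPMF t q h).toMeasure) univ MeasurableSet.univ
  simpa [MeasureTheory.Measure.pi_singleton, PMF.toMeasure_apply_singleton, blockPMF_apply]
    using this

theorem ediam_le_of_itinerary_eq {s : Set ℝ} {k N : ℕ} (hs : s ⊆ Ioc 0 1)
    (h : ∀ x ∈ s, ∀ y ∈ s, ∀ i < k, itinerary x i = itinerary y i)
    (hN : ∀ x ∈ s, N ≤ blockLength (itinerary x) k) :
    Metric.ediam s ≤ ENNReal.ofReal ((1 / 2) ^ N) := by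
  refine Metric.ediam_le fun x hx y hy => ?_
  rw [edist_dist, Real.dist_eq]
  exact ENNReal.ofReal_le_ofReal ((abs_sub_le_of_itinerary_eq (hs hx) (hs hy) (h x hx y hy)).trans
    (pow_le_pow_of_le_one (by norm_num) (by norm_num) (hN x hx)))

/-- For a nonempty cylinder of `n ≥ K` blocks, `diam^(t + q β) ≤ 2^(-(t L + q β L)) ≤ 2^(-(t L + q
S))`, using `S ≤ β L` and `q > 0`. The right-hand sides sum to `1` over all words, so the Hausdorff
measure is at most `1`. -/
theorem dimH_le_of_blockSum_le {t q β : ℝ} (h : HasSum (pressureTerm t q) 1) (hq : 0 < q)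
    (hd : 0 < t + q * β) (K : ℕ) :
    dimH {x ∈ Ioc (0 : ℝ) 1 | ∀ k ≥ K, blockSum (itinerary x) k ≤
      β * blockLength (itinerary x) k} ≤ ENNReal.ofReal (t + q * β) := by
  set s := {x ∈ Ioc (0 : ℝ) 1 | ∀ k ≥ K, blockSum (itinerary x) k ≤
      β * blockLength (itinerary x) k}
  let cyl : ∀ n : ℕ, (Fin n → ℕ) → Set ℝ := fun n a => {x ∈ s | ∀ i : Fin n, itinerary x i = a i}
  have hcyl : ∀ n a, ∀ x ∈ cyl n a, ∀ y ∈ cyl n a, ∀ i < n, itinerary x i = itinerary y i :=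
    fun n a x hx y hy i hi => (hx.2 ⟨i, hi⟩).trans (hy.2 ⟨i, hi⟩).symm
  have hsub : ∀ n a, cyl n a ⊆ Ioc 0 1 := fun n a x hx => hx.1.1
  have key := MeasureTheory.Measure.hausdorffMeasure_le_liminf_tsum (ι := fun n : ℕ => Fin n → ℕ)
    (t + q * β) s (l := atTop) (fun n => ENNReal.ofReal ((1 / 2) ^ n)) (by
      rw [← ENNReal.ofReal_zero]
      exact ENNReal.tendsto_ofReal
        (tendsto_pow_atTop_nhds_zero_of_lt_one (by norm_num) (by norm_num))) cyl
    (Eventually.of_forall fun n a => ediam_le_of_itinerary_eq (hsub n a) (hcyl n a)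
      fun x _ => (blockLength_strictMono _).id_le n)
    (Eventually.of_forall fun n x hx =>
      mem_iUnion.2 ⟨fun i => itinerary x i, hx, fun i => rfl⟩)
  have hle : MeasureTheory.Measure.hausdorffMeasure (t + q * β) s ≤ 1 := by
    refine key.trans (liminf_le_of_frequently_le' (Eventually.frequently ?_))
    filter_upwards [eventually_ge_atTop K] with n hn
    rw [← tsum_prod_pressureTerm h n]
    refine ENNReal.tsum_le_tsum fun a => ?_
    rcases (cyl n a).eq_empty_or_nonempty with he | ⟨x, hx⟩
    · rw [he, Metric.ediam_empty, ENNReal.zero_rpow_of_pos hd]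
      exact zero_le
    · have e1 : ∏ i, ENNReal.ofReal (pressureTerm t q (a i)) =
          ENNReal.ofReal (∏ i ∈ Finset.range n, pressureTerm t q (itinerary x i)) := by
        rw [ENNReal.ofReal_prod_of_nonneg fun i _ => (pressureTerm_pos _ _ _).le,
          ← Fin.prod_univ_eq_prod_range fun i => ENNReal.ofReal (pressureTerm t q (itinerary x i))]
        exact Finset.prod_congr rfl fun i _ => by rw [hx.2 i]
      have e2 := ediam_le_of_itinerary_eq (N := blockLength (itinerary x) n) (hsub n a) (hcyl n a)
        fun y hy => (blockLength_congr (hcyl n a x hx y hy)).le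
      refine (ENNReal.rpow_le_rpow e2 hd.le).trans ?_
      rw [e1, prod_pressureTerm, ENNReal.ofReal_rpow_of_nonneg (by positivity) hd.le]
      apply ENNReal.ofReal_le_ofReal
      rw [one_div, ← Real.rpow_natCast, Real.inv_rpow two_pos.le, ← Real.rpow_neg two_pos.le,
        ← Real.rpow_mul two_pos.le]
      apply Real.rpow_le_rpow_of_exponent_le one_le_two
      nlinarith [mul_le_mul_of_nonneg_left (hx.1.2 n hn) hq.le]
  have := dimH_le_of_hausdorffMeasure_ne_top (s := s) (d := ⟨t + q * β, hd.le⟩)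
    (hle.trans_lt ENNReal.one_lt_top).ne
  convert this
  exact ENNReal.ofReal_eq_coe_nnreal hd.le

/-- For each `β > α` the level set is a countable union, over the starting index `K`, of sets where
`S ≤ β L` from `K` on; countable stability of dimension and `β ↓ α` conclude. -/
theorem dimH_birkhoffLevelSet_le {t q α : ℝ} (h : HasSum (pressureTerm t q) 1) (hq : 0 < q)
    (hd : 0 ≤ t + q * α) : dimH (birkhoffLevelSet α) ≤ ENNReal.ofReal (t + q * α) := by
  have hlim : Tendsto (fun β => ENNReal.ofReal (t + q * β)) (𝓝[>] α)
      (𝓝 (ENNReal.ofReal (t + q * α))) := by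
    refine (ENNReal.tendsto_ofReal ?_).mono_left nhdsWithin_le_nhds
    exact (Continuous.tendsto (by fun_prop) α)
  refine ge_of_tendsto hlim ?_
  filter_upwards [self_mem_nhdsWithin] with β hβ
  have hβ' : α < β := hβ
  have hd' : 0 < t + q * β := by nlinarith
  have hsub : birkhoffLevelSet α ⊆ ⋃ K : ℕ, {x ∈ Ioc (0 : ℝ) 1 | ∀ k ≥ K,
      blockSum (itinerary x) k ≤ β * blockLength (itinerary x) k} := by
    intro x hx
    have h1 := (tendsto_blockSum_div_of_mem hx).eventually_lt_const hβ'
    obtain ⟨K, hK⟩ := eventually_atTop.1 (h1.and (eventually_gt_atTop 0))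
    refine mem_iUnion.2 ⟨K, hx.1, fun k hk => ?_⟩
    obtain ⟨h2, h3⟩ := hK k hk
    have h4 : (0 : ℝ) < blockLength (itinerary x) k := by
      exact_mod_cast h3.trans_le ((blockLength_strictMono (itinerary x)).id_le k)
    exact ((div_lt_iff₀ h4).1 h2).le
  refine (dimH_mono hsub).trans ?_
  rw [dimH_iUnion]
  exact iSup_le fun K => dimH_le_of_blockSum_le h hq hd' K

/-! ### The inverse coding from block sequences to points -/

/-- The point of `(0,1]` whose binary expansion has the given sequence of blocks. -/
noncomputable def codingMap (a : ℕ → ℕ) : ℝ := ∑' k, (1 / 2 : ℝ) ^ blockLength a (k + 1)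

theorem half_pow_blockLength_le (a : ℕ → ℕ) (k : ℕ) :
    (1 / 2 : ℝ) ^ blockLength a (k + 1) ≤ 1 / 2 * (1 / 2) ^ k := by
  rw [← pow_succ']
  exact pow_le_pow_of_le_one (by norm_num) (by norm_num) ((blockLength_strictMono a).id_le _)

theorem summable_half_pow_blockLength (a : ℕ → ℕ) :
    Summable fun k => (1 / 2 : ℝ) ^ blockLength a (k + 1) :=
  Summable.of_nonneg_of_le (fun k => by positivity) (half_pow_blockLength_le a)
    (summable_geometric_two.mul_left _)

theorem codingMap_mem (a : ℕ → ℕ) : codingMap a ∈ Ioc (0 : ℝ) 1 := by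
  constructor
  · exact (summable_half_pow_blockLength a).tsum_pos (fun k => by positivity) 0 (by positivity)
  · have := (summable_half_pow_blockLength a).tsum_le_tsum (half_pow_blockLength_le a)
      (summable_geometric_two.mul_left _)
    rw [tsum_mul_left, tsum_geometric_two] at this
    unfold codingMap
    linarith

theorem codingMap_eq (a : ℕ → ℕ) :
    codingMap a = (1 / 2) ^ (a 0 + 1) * (1 + codingMap fun i => a (i + 1)) := by
  rw [codingMap, (summable_half_pow_blockLength a).tsum_eq_zero_add, codingMap, mul_add, mul_one,
    ← tsum_mul_left]
  refine congrArg₂ (· + ·) (by simp [blockLength]) (tsum_congr fun k => ?_)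
  rw [blockLength_succ', pow_add, mul_comm]

theorem leadingZeros_codingMap (a : ℕ → ℕ) : leadingZeros (codingMap a) = a 0 := by
  apply leadingZeros_eq
  obtain ⟨h1, h2⟩ := codingMap_mem fun i => a (i + 1)
  have h3 : (0 : ℝ) < (1 / 2) ^ (a 0 + 1) := by positivity
  rw [codingMap_eq]
  constructor
  · nlinarith
  · have : (1 / 2 : ℝ) ^ a 0 = (1 / 2) ^ (a 0 + 1) * 2 := by ring
    rw [this]
    gcongr
    linarith

theorem inducedMap_codingMap (a : ℕ → ℕ) :
    inducedMap (codingMap a) = codingMap fun i => a (i + 1) := by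
  rw [inducedMap, leadingZeros_codingMap, codingMap_eq a, ← mul_assoc, ← mul_pow]
  norm_num

theorem itinerary_codingMap (a : ℕ → ℕ) : itinerary (codingMap a) = a := by
  ext k
  induction k generalizing a with
  | zero => exact leadingZeros_codingMap a
  | succ k ih => rw [← itinerary_inducedMap, inducedMap_codingMap, ih]

theorem measurable_codingMap : Measurable codingMap := by
  apply Continuous.measurable
  refine continuous_tsum (u := fun k : ℕ => 1 / 2 * (1 / 2 : ℝ) ^ k) (fun k => ?_)
    (summable_geometric_two.mul_left _) fun k a => ?_
  · have h1 : Continuous fun a : ℕ → ℕ => blockLength a (k + 1) :=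
      continuous_finsetSum _ fun i _ => by fun_prop
    exact (continuous_of_discreteTopology (f := fun n : ℕ => (1 / 2 : ℝ) ^ n)).comp h1
  · rw [Real.norm_of_nonneg (by positivity)]
    exact half_pow_blockLength_le a k

/-! ### Independent blocks and the law of large numbers -/

open MeasureTheory ProbabilityTheory

/-- The law of a sequence of independent blocks with Gibbs distribution. -/
noncomputable def blockMeasure (t q : ℝ) (h : HasSum (pressureTerm t q) 1) : Measure (ℕ → ℕ) :=
  Measure.infinitePi fun _ : ℕ => (blockPMF t q h).toMeasure

instance (t q : ℝ) (h : HasSum (pressureTerm t q) 1) :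
    IsProbabilityMeasure (blockMeasure t q h) := by
  unfold blockMeasure; infer_instance

theorem blockMeasure_cylinder {t q : ℝ} (h : HasSum (pressureTerm t q) 1) (a : ℕ → ℕ) (k : ℕ) :
    blockMeasure t q h {b | ∀ i < k, b i = a i} =
      ENNReal.ofReal ((2 : ℝ) ^ (-(t * blockLength a k + q * blockSum a k))) := by
  have e : {b : ℕ → ℕ | ∀ i < k, b i = a i} =
      (Finset.range k : Set ℕ).pi fun i => {a i} := by
    ext b; simp [Set.mem_pi]
  rw [e, blockMeasure, Measure.infinitePi_pi _ fun i _ => MeasurableSet.singleton _,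
    ← prod_pressureTerm, ENNReal.ofReal_prod_of_nonneg fun i _ => (pressureTerm_pos _ _ _).le]
  exact Finset.prod_congr rfl fun i _ => by
    rw [PMF.toMeasure_apply_singleton _ _ (MeasurableSet.singleton _), blockPMF_apply]

theorem ae_tendsto_blockAverage {t q : ℝ} (h : HasSum (pressureTerm t q) 1) {f : ℕ → ℝ}
    (hf : ∀ j, 0 ≤ f j) {M : ℝ} (hM : HasSum (fun j => f j * pressureTerm t q j) M) :
    ∀ᵐ ω ∂blockMeasure t q h,
      Tendsto (fun n : ℕ => (∑ i ∈ Finset.range n, f (ω i)) / n) atTop (𝓝 M) := by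
  have hmeas : Measurable f := measurable_of_countable f
  have hint : Integrable f (blockPMF t q h).toMeasure := by
    refine ⟨hmeas.aestronglyMeasurable, ?_⟩
    rw [hasFiniteIntegral_iff_ofReal (ae_of_all _ hf), lintegral_countable']
    have e : ∀ j, ENNReal.ofReal (f j) * (blockPMF t q h).toMeasure {j} =
        ENNReal.ofReal (f j * pressureTerm t q j) := fun j => by
      rw [PMF.toMeasure_apply_singleton _ _ (MeasurableSet.singleton _), blockPMF_apply,
        ENNReal.ofReal_mul (hf j)]
    simp_rw [e]
    exact hM.summable.tsum_ofReal_lt_top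
  have hev : ∀ i, MeasurePreserving (fun ω : ℕ → ℕ => ω i) (blockMeasure t q h)
    (blockPMF t q h).toMeasure := fun i => measurePreserving_eval_infinitePi _ i
  have hval : ∫ ω, f (ω 0) ∂blockMeasure t q h = M := by
    rw [← hM.tsum_eq, ← integral_map (φ := fun ω : ℕ → ℕ => ω 0) (hev 0).measurable.aemeasurable
      hmeas.aestronglyMeasurable, (hev 0).map_eq, PMF.integral_eq_tsum _ _ hint]
    refine tsum_congr fun j => ?_
    rw [blockPMF_apply, ENNReal.toReal_ofReal (pressureTerm_pos _ _ _).le, smul_eq_mul, mul_comm]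
  rw [← hval]
  refine strong_law_ae_real (fun i (ω : ℕ → ℕ) => f (ω i))
    (((hev 0).integrable_comp hmeas.aestronglyMeasurable).2 hint) (fun i j hij => ?_) fun i => ?_
  · exact (iIndepFun_infinitePi (P := fun _ : ℕ => (blockPMF t q h).toMeasure)
      (X := fun _ => f) fun _ => hmeas).indepFun hij
  · refine IdentDistrib.comp (u := f) (f := fun ω : ℕ → ℕ => ω i) (g := fun ω : ℕ → ℕ => ω 0)
      ⟨(hev i).measurable.aemeasurable, (hev 0).measurable.aemeasurable, ?_⟩ hmeas
    rw [(hev i).map_eq, (hev 0).map_eq]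

/-! ### Mass distribution and the lower bound for the dimension -/

theorem ceil_two_pow_mul_eq_of_le {x y : ℝ} {m n : ℕ} (hmn : m ≤ n)
    (h : ⌈2 ^ n * x⌉ = ⌈2 ^ n * y⌉) : ⌈2 ^ m * x⌉ = ⌈2 ^ m * y⌉ := by
  obtain ⟨d, rfl⟩ := Nat.exists_eq_add_of_le hmn
  refine eq_of_forall_lt_iff fun z => ?_
  have key : ∀ u : ℝ, z < ⌈2 ^ m * u⌉ ↔ 2 ^ d * z < ⌈2 ^ (m + d) * u⌉ := fun u => by
    rw [Int.lt_ceil, Int.lt_ceil, pow_add, mul_comm (2 ^ m : ℝ) (2 ^ d), mul_assoc]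
    push_cast
    rw [mul_lt_mul_iff_right₀ (by positivity)]
  rw [key, key, h]

/-- Points at distance at most `2^(-n)` have ceilings at scale `2^n` differing by at most one, so
three dyadic intervals suffice. -/
theorem subset_dyadic_of_ediam_le {s : Set ℝ} {n : ℕ} {x : ℝ} (hx : x ∈ s)
    (hs : Metric.ediam s ≤ ENNReal.ofReal ((1 / 2) ^ n)) :
    s ⊆ ⋃ m ∈ Finset.Icc (⌈2 ^ n * x⌉ - 1) (⌈2 ^ n * x⌉ + 1), {y : ℝ | ⌈2 ^ n * y⌉ = m} := by
  intro y hy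
  have h1 := (Metric.edist_le_ediam_of_mem hy hx).trans hs
  rw [edist_dist, ENNReal.ofReal_le_ofReal_iff (by positivity), Real.dist_eq, abs_le,
    one_div_pow] at h1
  have h2 : (2 : ℝ) ^ n * (1 / 2 ^ n) = 1 := by field_simp
  have h3 : (2 : ℝ) ^ n * y ≤ 2 ^ n * x + 1 := by
    have := mul_le_mul_of_nonneg_left h1.2 (by positivity : (0 : ℝ) ≤ 2 ^ n)
    linarith
  have h4 : (2 : ℝ) ^ n * x ≤ 2 ^ n * y + 1 := by
    have := mul_le_mul_of_nonneg_left h1.1 (by positivity : (0 : ℝ) ≤ 2 ^ n)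
    linarith
  have h5 := Int.ceil_mono h3
  have h6 := Int.ceil_mono h4
  rw [Int.ceil_add_one] at h5 h6
  simp only [mem_iUnion, Finset.mem_Icc]
  exact ⟨_, ⟨by omega, by omega⟩, rfl⟩

/-- A mass distribution principle on the line, in terms of dyadic intervals. -/
theorem hausdorffMeasure_ne_zero_of_dyadic (m : Measure ℝ) {d : ℝ} (hd : 0 < d) {n₀ : ℕ}
    (hm : ∀ n ≥ n₀, ∀ z : ℤ, m {y : ℝ | ⌈2 ^ n * y⌉ = z} ≤ ENNReal.ofReal ((2 : ℝ) ^ (-(d * n))))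
    {s : Set ℝ} (hs : m s ≠ 0) : Measure.hausdorffMeasure d s ≠ 0 := by
  have hball : ∀ u : Set ℝ, ∀ n ≥ n₀, Metric.ediam u ≤ ENNReal.ofReal ((1 / 2) ^ n) →
      m u ≤ 3 * ENNReal.ofReal ((2 : ℝ) ^ (-(d * n))) := by
    intro u n hn hu
    rcases u.eq_empty_or_nonempty with rfl | ⟨x, hx⟩
    · simp
    refine (measure_mono (subset_dyadic_of_ediam_le hx hu)).trans ?_
    refine (measure_biUnion_finset_le _ _).trans ?_
    refine (Finset.sum_le_card_nsmul _ _ _ fun z _ => hm n hn z).trans ?_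
    have : (Finset.Icc (⌈2 ^ n * x⌉ - 1) (⌈2 ^ n * x⌉ + 1)).card = 3 := by
      rw [Int.card_Icc]; omega
    rw [this]; simp
  -- The factor `3` counts dyadic intervals; `2^d` pays for rounding the diameter up to a power of
  -- `1/2`.
  set C : ENNReal := 3 * ENNReal.ofReal (2 ^ d)
  have hC0 : C ≠ 0 := by simp [C]; positivity
  have hCtop : C ≠ ⊤ := ENNReal.mul_ne_top (by norm_num) ENNReal.ofReal_ne_top
  have hmass : ∀ u : Set ℝ, Metric.ediam u ≤ ENNReal.ofReal ((1 / 2) ^ n₀) →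
      m u ≤ C * Metric.ediam u ^ d := by
    intro u hu
    -- A set of diameter zero has no dyadic scale of its own; its mass vanishes because the bound
    -- holds for every large `n`.
    rcases eq_or_ne (Metric.ediam u) 0 with h0 | h0
    · have hlim : Tendsto (fun n : ℕ => 3 * ENNReal.ofReal ((2 : ℝ) ^ (-(d * n)))) atTop
          (𝓝 (3 * ENNReal.ofReal 0)) := by
        refine ENNReal.Tendsto.const_mul (ENNReal.tendsto_ofReal ?_) (Or.inr (by norm_num))
        have e : ∀ n : ℕ, (2 : ℝ) ^ (-(d * n)) = ((2 : ℝ) ^ (-d)) ^ n := fun n => by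
          rw [← Real.rpow_natCast, ← Real.rpow_mul two_pos.le]; ring_nf
        simp_rw [e]
        exact tendsto_pow_atTop_nhds_zero_of_lt_one (by positivity)
          (Real.rpow_lt_one_of_one_lt_of_neg one_lt_two (by linarith))
      have hz : m u ≤ 3 * ENNReal.ofReal 0 := by
        refine ge_of_tendsto hlim ?_
        filter_upwards [eventually_ge_atTop n₀] with n hn
        exact hball u n hn (by rw [h0]; exact zero_le)
      simp only [ENNReal.ofReal_zero, mul_zero] at hz
      exact hz.trans (zero_le)
    · have htop : Metric.ediam u ≠ ⊤ := (hu.trans_lt ENNReal.ofReal_lt_top).ne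
      set r := (Metric.ediam u).toReal
      have hr : Metric.ediam u = ENNReal.ofReal r := (ENNReal.ofReal_toReal htop).symm
      have hr0 : 0 < r := ENNReal.toReal_pos h0 htop
      rw [hr, ENNReal.ofReal_le_ofReal_iff (by positivity)] at hu
      obtain ⟨n, hn1, hn2⟩ := exists_nat_pow_near_of_lt_one hr0
        (hu.trans (pow_le_one₀ (by norm_num) (by norm_num)))
        (by norm_num : (0 : ℝ) < 1 / 2) (by norm_num)
      have hn : n₀ ≤ n := by
        have := (pow_lt_pow_iff_right_of_lt_one₀ (by norm_num : (0 : ℝ) < 1 / 2)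
          (by norm_num)).1 (hn1.trans_le hu)
        omega
      refine (hball u n hn (by rw [hr]; exact ENNReal.ofReal_le_ofReal hn2)).trans ?_
      rw [hr, ENNReal.ofReal_rpow_of_pos hr0, mul_assoc, ← ENNReal.ofReal_mul (by positivity)]
      gcongr
      have e : (2 : ℝ) ^ (-(d * n)) = 2 ^ d * ((1 / 2) ^ (n + 1)) ^ d := by
        rw [one_div, ← Real.rpow_natCast, Real.inv_rpow two_pos.le, ← Real.rpow_neg two_pos.le,
          ← Real.rpow_mul two_pos.le, ← Real.rpow_add two_pos]
        congr 1; push_cast; ring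
      rw [e]
      gcongr
  have hle : C⁻¹ • m ≤ Measure.hausdorffMeasure d := by
    refine Measure.le_hausdorffMeasure d _ (ENNReal.ofReal ((1 / 2) ^ n₀)) (by simp) fun u hu => ?_
    rw [Measure.smul_apply, smul_eq_mul, ENNReal.inv_mul_le_iff hC0 hCtop]
    exact hmass u hu
  intro h0
  have := hle s
  rw [h0, Measure.smul_apply, smul_eq_mul, nonpos_iff_eq_zero, mul_eq_zero] at this
  exact this.elim (ENNReal.inv_ne_zero.2 hCtop) hs

/-- If `k` blocks of `ω` fit into `n` digits, the order-`n` dyadic interval of its point lies in the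
`k`-block cylinder, of mass `2^(-(t L_k + q S_k))`. Almost surely `(t L_k + q S_k) / L_{k+1}` tends
to `t + q B / A`, and `n < L_{k+1}`, so the mass is at most `2^(-d n)` for each `d` below this limit
and `n` large. -/
theorem le_dimH_birkhoffLevelSet {t q A B : ℝ} (h : HasSum (pressureTerm t q) 1)
    (hA : HasSum (fun j : ℕ => ((j : ℝ) + 1) * pressureTerm t q j) A)
    (hB : HasSum (fun j : ℕ => ((2 : ℝ) ^ (j + 1) - 1) * pressureTerm t q j) B) :
    ENNReal.ofReal (t + q * (B / A)) ≤ dimH (birkhoffLevelSet (B / A)) := by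
  have hA0 : 0 < A := by
    rw [← hA.tsum_eq]
    exact hA.summable.tsum_pos (fun j => mul_nonneg (by positivity) (pressureTerm_pos t q j).le) 0
      (mul_pos (by positivity) (pressureTerm_pos t q 0))
  refine le_of_forall_lt fun c hc => ?_
  obtain ⟨d, hcd, hd⟩ := ENNReal.lt_iff_exists_nnreal_btwn.1 hc
  refine hcd.trans_le ?_
  have hd0 : 0 < (d : ℝ) := by
    rw [NNReal.coe_pos]
    exact ENNReal.coe_pos.1 ((zero_le).trans_lt hcd)
  have hd1 : (d : ℝ) < t + q * (B / A) := by
    have := (ENNReal.lt_ofReal_iff_toReal_lt ENNReal.coe_ne_top).1 hd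
    simpa using this
  -- The threshold for `n` depends on `ω`. Restricting the measure to some `G n₀` of positive mass
  -- makes it uniform: a dyadic interval meeting the image of `G n₀` is estimated through a point of
  -- `G n₀` in it.
  set G : ℕ → Set (ℕ → ℕ) := fun n₀ => {ω | codingMap ω ∈ birkhoffLevelSet (B / A) ∧
    ∀ n ≥ n₀, d * n ≤ t * blockLength ω (blockIndex ω n) + q * blockSum ω (blockIndex ω n)}
  have hG : ∀ᵐ ω ∂blockMeasure t q h, ω ∈ ⋃ n₀, G n₀ := by
    filter_upwards [ae_tendsto_blockAverage h (fun j => by positivity) hA,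
      ae_tendsto_blockAverage h (fun j => sub_nonneg.2 (one_le_pow₀ one_le_two)) hB] with ω h1 h2
    have h1' : Tendsto (fun k : ℕ => (blockLength ω k : ℝ) / k) atTop (𝓝 A) := by
      simpa [blockLength] using h1
    have h3 := tendsto_div_shift (u := fun k => t * blockLength ω k + q * blockSum ω k) hA0.ne'
      (B := t * A + q * B) (((h1'.const_mul t).add (h2.const_mul q)).congr fun k => by
        rw [← blockSum]; ring) h1' 0 1
    have e : (t * A + q * B) / A = t + q * (B / A) := by field_simp
    rw [e] at h3
    obtain ⟨n₀, hn₀⟩ := eventually_atTop.1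
      ((tendsto_blockIndex ω).eventually (h3.eventually_const_lt hd1))
    refine mem_iUnion.2 ⟨n₀, mem_birkhoffLevelSet (codingMap_mem ω) hA0.ne'
      (by rwa [itinerary_codingMap]) (by rwa [itinerary_codingMap]), fun n hn => ?_⟩
    have h4 : (n : ℝ) < blockLength ω (blockIndex ω n + 1) := by
      exact_mod_cast lt_blockLength_blockIndex_succ ω n
    have h5 := (lt_div_iff₀ ((Nat.cast_nonneg n).trans_lt h4)).1 (hn₀ n hn)
    rw [add_zero] at h5
    exact (mul_le_mul_of_nonneg_left h4.le hd0.le).trans h5.le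
  obtain ⟨n₀, hn₀⟩ : ∃ n₀, blockMeasure t q h (G n₀) ≠ 0 := by
    by_contra! h0
    have h1 := measure_iUnion_null h0
    have h2 : blockMeasure t q h univ = 0 := by
      refine measure_mono_null (fun ω _ => ?_) (measure_union_null h1 (ae_iff.1 hG))
      exact (em _)
    simp at h2
  apply le_dimH_of_hausdorffMeasure_ne_zero
  refine hausdorffMeasure_ne_zero_of_dyadic (((blockMeasure t q h).restrict (G n₀)).map codingMap)
    hd0 (n₀ := n₀) (fun n hn z => ?_) fun h0 => hn₀ ?_
  · have hz : MeasurableSet {y : ℝ | ⌈2 ^ n * y⌉ = z} :=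
      (Int.measurable_ceil.comp (measurable_const_mul _)) (MeasurableSet.singleton z)
    rw [Measure.map_apply measurable_codingMap hz,
      Measure.restrict_apply (measurable_codingMap hz)]
    rcases (codingMap ⁻¹' {y : ℝ | ⌈2 ^ n * y⌉ = z} ∩ G n₀).eq_empty_or_nonempty with he | ⟨ω, hω⟩
    · rw [he, measure_empty]
      exact zero_le
    refine (measure_mono (t := {b | ∀ i < blockIndex ω n, b i = ω i}) ?_).trans ?_
    · intro b hb
      have h1 : ⌈2 ^ n * codingMap ω⌉ = ⌈2 ^ n * codingMap b⌉ := hω.1.trans hb.1.symm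
      have h2 := itinerary_eq_of_ceil_eq (k := blockIndex ω n) (codingMap_mem ω) (codingMap_mem b)
      rw [itinerary_codingMap, itinerary_codingMap] at h2
      intro i hi
      exact (h2 (ceil_two_pow_mul_eq_of_le (blockLength_blockIndex_le ω n) h1) i hi).symm
    · rw [blockMeasure_cylinder]
      apply ENNReal.ofReal_le_ofReal
      apply Real.rpow_le_rpow_of_exponent_le one_le_two
      exact neg_le_neg (hω.2.2 n hn)
  -- This inequality holds for arbitrary sets, so measurability of the level set is not needed.
  · have h1 := Measure.le_map_apply (μ := (blockMeasure t q h).restrict (G n₀))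
      measurable_codingMap.aemeasurable (birkhoffLevelSet (B / A))
    rw [h0, nonpos_iff_eq_zero, Measure.restrict_apply_superset fun ω hω => hω.1] at h1
    exact h1

/-! ### Analyticity of series of exponentials of linear functionals -/

/-- The `n`-th power of a continuous linear functional, as a multilinear map. -/
noncomputable def ContinuousLinearMap.multilinearPow {E : Type*} [NormedAddCommGroup E]
    [NormedSpace ℝ E] (L : E →L[ℝ] ℝ) (n : ℕ) : ContinuousMultilinearMap ℝ (fun _ : Fin n => E) ℝ :=
  (ContinuousMultilinearMap.mkPiAlgebraFin ℝ n ℝ).compContinuousLinearMap fun _ => L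

theorem ContinuousLinearMap.multilinearPow_apply {E : Type*} [NormedAddCommGroup E]
    [NormedSpace ℝ E] (L : E →L[ℝ] ℝ) (n : ℕ) (v : E) :
    L.multilinearPow n (fun _ => v) = L v ^ n := by
  simp [multilinearPow]

theorem ContinuousLinearMap.norm_multilinearPow_le {E : Type*} [NormedAddCommGroup E]
    [NormedSpace ℝ E] (L : E →L[ℝ] ℝ) (n : ℕ) : ‖L.multilinearPow n‖ ≤ ‖L‖ ^ n := by
  refine (ContinuousMultilinearMap.norm_compContinuousLinearMap_le _ _).trans ?_
  simp

/-- The power series of `v ↦ ∑ c j * exp (L j v)`. -/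
noncomputable def expSumSeries {E : Type*} [NormedAddCommGroup E] [NormedSpace ℝ E]
    (c : ℕ → ℝ) (L : ℕ → E →L[ℝ] ℝ) : FormalMultilinearSeries ℝ E ℝ :=
  fun n => ∑' j, (c j / n.factorial) • (L j).multilinearPow n

theorem norm_expSumSeries_term_le {E : Type*} [NormedAddCommGroup E] [NormedSpace ℝ E]
    (c : ℕ → ℝ) (L : ℕ → E →L[ℝ] ℝ) (n j : ℕ) :
    ‖(c j / n.factorial) • (L j).multilinearPow n‖ ≤ |c j| * (‖L j‖ ^ n / n.factorial) := by
  rw [norm_smul, norm_div, Real.norm_eq_abs, RCLike.norm_natCast, div_mul_eq_mul_div,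
    mul_div_assoc]
  gcongr
  exact (L j).norm_multilinearPow_le n

theorem norm_expSumSeries_le {E : Type*} [NormedAddCommGroup E] [NormedSpace ℝ E]
    {c : ℕ → ℝ} {L : ℕ → E →L[ℝ] ℝ} {n : ℕ}
    (hs : Summable fun j => |c j| * (‖L j‖ ^ n / n.factorial)) :
    ‖expSumSeries c L n‖ ≤ ∑' j, |c j| * (‖L j‖ ^ n / n.factorial) := by
  have h1 := norm_expSumSeries_term_le c L n
  have h2 : Summable fun j => ‖(c j / n.factorial) • (L j).multilinearPow n‖ :=
    Summable.of_nonneg_of_le (fun j => norm_nonneg _) h1 hs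
  exact (norm_tsum_le_tsum_norm h2).trans (h2.tsum_le_tsum h1 hs)

theorem abs_mul_pow_div_factorial_mul_le (a x r : ℝ) (hx : 0 ≤ x) (hr : 0 ≤ r) (n : ℕ) :
    |a| * (x ^ n / n.factorial) * r ^ n ≤ |a| * Real.exp (r * x) := by
  rw [mul_assoc, div_mul_eq_mul_div, ← mul_pow, mul_comm x]
  gcongr
  exact Real.pow_div_factorial_le_exp _ (by positivity) n

theorem summable_expSumSeries_bound {E : Type*} [NormedAddCommGroup E] [NormedSpace ℝ E]
    {c : ℕ → ℝ} {L : ℕ → E →L[ℝ] ℝ} {r : ℝ} (hr : 0 < r)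
    (hs : Summable fun j => |c j| * Real.exp (r * ‖L j‖)) (n : ℕ) :
    Summable fun j => |c j| * (‖L j‖ ^ n / n.factorial) :=
  (summable_mul_right_iff (pow_pos hr n).ne').1 (Summable.of_nonneg_of_le
    (fun j => by positivity)
    (fun j => abs_mul_pow_div_factorial_mul_le _ _ _ (norm_nonneg _) hr.le n) hs)

theorem hasSum_expSumSeries {E : Type*} [NormedAddCommGroup E] [NormedSpace ℝ E]
    {c : ℕ → ℝ} {L : ℕ → E →L[ℝ] ℝ} {r : ℝ} (hr : 0 < r)
    (hs : Summable fun j => |c j| * Real.exp (r * ‖L j‖)) (n : ℕ) (v : E) :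
    HasSum (fun j => c j * (L j v ^ n / n.factorial)) (expSumSeries c L n fun _ => v) := by
  have h1 : Summable fun j => (c j / n.factorial) • (L j).multilinearPow n :=
    Summable.of_norm_bounded (summable_expSumSeries_bound hr hs n)
      (norm_expSumSeries_term_le c L n)
  have h2 := ContinuousMultilinearMap.hasSum_eval h1.hasSum fun _ => v
  refine h2.congr_fun fun j => ?_
  rw [smul_apply, ContinuousLinearMap.multilinearPow_apply, smul_eq_mul]
  ring

theorem Real.hasSum_pow_div_factorial (x : ℝ) :
    HasSum (fun n : ℕ => x ^ n / n.factorial) (Real.exp x) := by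
  rw [Real.exp_eq_exp_ℝ]
  exact NormedSpace.expSeries_div_hasSum_exp x

/-- A series of exponentials of continuous linear functionals is analytic. -/
theorem hasFPowerSeriesOnBall_tsum_mul_exp {E : Type*} [NormedAddCommGroup E] [NormedSpace ℝ E]
    (c : ℕ → ℝ) (L : ℕ → E →L[ℝ] ℝ) {r : NNReal} (hr : 0 < r)
    (hs : Summable fun j => |c j| * Real.exp (r * ‖L j‖)) :
    HasFPowerSeriesOnBall (fun v => ∑' j, c j * Real.exp (L j v)) (expSumSeries c L) 0 r := by
  have hr' : (0 : ℝ) < r := NNReal.coe_pos.2 hr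
  have hsum := summable_expSumSeries_bound hr' hs
  refine ⟨FormalMultilinearSeries.le_radius_of_bound _ (∑' j, |c j| * Real.exp (r * ‖L j‖))
    fun n => ?_, by exact_mod_cast hr, fun {v} hv => ?_⟩
  · have h1 := norm_expSumSeries_le (hsum n)
    refine (mul_le_mul_of_nonneg_right h1 (pow_pos hr' n).le).trans ?_
    rw [← tsum_mul_right]
    exact ((hsum n).mul_right _).tsum_le_tsum
      (fun j => abs_mul_pow_div_factorial_mul_le _ _ _ (norm_nonneg _) hr'.le n) hs
  · have hv' : ‖v‖ < r := by simpa using hv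
    -- Absolute convergence of the double series, from expanding each `exp (r ‖L j‖)`, justifies
    -- exchanging the sums over `j` and over the degree.
    have habs : Summable fun p : ℕ × ℕ => |c p.1| * ((r * ‖L p.1‖) ^ p.2 / p.2.factorial) := by
      have hj := fun j => (Real.hasSum_pow_div_factorial (r * ‖L j‖)).mul_left |c j|
      refine (summable_prod_of_nonneg fun p => by positivity).2 ⟨fun j => (hj j).summable, ?_⟩
      simp only [(hj _).tsum_eq]
      exact hs
    have hjoint : Summable fun p : ℕ × ℕ => c p.1 * (L p.1 v ^ p.2 / p.2.factorial) := by
      refine Summable.of_norm_bounded habs fun p => ?_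
      rw [norm_mul, norm_div, norm_pow, RCLike.norm_natCast, Real.norm_eq_abs]
      gcongr
      refine ((L p.1).le_opNorm v).trans ?_
      rw [mul_comm]
      gcongr
    have h1 := hjoint.hasSum.prod_fiberwise fun j =>
      (Real.hasSum_pow_div_factorial (L j v)).mul_left (c j)
    have h2 := (Equiv.prodComm ℕ ℕ).hasSum_iff.2 hjoint.hasSum
    rw [zero_add, h1.tsum_eq]
    exact h2.prod_fiberwise fun n => hasSum_expSumSeries hr' hs n v

/-! ### Analyticity of the weighted pressure series -/

theorem summable_pressureTerm (t : ℝ) {q : ℝ} (hq : 0 < q) : Summable (pressureTerm t q) := by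
  refine summable_of_ratio_test_tendsto_lt_one (l := 0) one_pos
    (Eventually.of_forall fun j => (pressureTerm_pos t q j).ne') ?_
  have e : ∀ j : ℕ, ‖pressureTerm t q (j + 1)‖ / ‖pressureTerm t q j‖ =
      (2 : ℝ) ^ (-(t + q * 2 ^ (j + 1))) := fun j => by
    rw [Real.norm_of_nonneg (pressureTerm_pos _ _ _).le,
      Real.norm_of_nonneg (pressureTerm_pos _ _ _).le, pressureTerm, pressureTerm,
      ← Real.rpow_sub two_pos]
    congr 1
    push_cast
    ring
  simp_rw [e]
  have h1 : Tendsto (fun j : ℕ => t + q * (2 : ℝ) ^ (j + 1)) atTop atTop :=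
    tendsto_atTop_add_const_left _ _ (((tendsto_pow_atTop_atTop_of_one_lt one_lt_two).comp
      (tendsto_add_atTop_nat 1)).const_mul_atTop hq)
  simp_rw [Real.rpow_neg two_pos.le]
  exact ((tendsto_rpow_atTop_of_base_gt_one 2 one_lt_two).comp h1).inv_tendsto_atTop

/-- Weights up to `4^(j+1)` cost only a shift of `t` by `2`, harmless since the series converges for
every real `t`. This covers the weights `1`, `j + 1` and `2^(j+1) - 1` used below. -/
theorem four_pow_mul_pressureTerm (t q : ℝ) (j : ℕ) :
    4 ^ (j + 1) * pressureTerm t q j = pressureTerm (t - 2) q j := by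
  have : (4 : ℝ) ^ (j + 1) = 2 ^ (2 * ((j : ℝ) + 1)) := by
    rw [show (2 * ((j : ℝ) + 1)) = ((2 * (j + 1) : ℕ) : ℝ) by push_cast; ring, Real.rpow_natCast,
      pow_mul]
    norm_num
  rw [this, pressureTerm, pressureTerm, ← Real.rpow_add two_pos]
  congr 1
  ring

theorem summable_mul_pressureTerm {w : ℕ → ℝ} (hw : ∀ j, |w j| ≤ 4 ^ (j + 1)) (t : ℝ) {q : ℝ}
    (hq : 0 < q) : Summable fun j => w j * pressureTerm t q j :=
  Summable.of_norm_bounded (summable_pressureTerm (t - 2) hq) fun j => by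
    rw [norm_mul, Real.norm_of_nonneg (pressureTerm_pos _ _ _).le, ← four_pow_mul_pressureTerm]
    exact mul_le_mul_of_nonneg_right (hw j) (pressureTerm_pos _ _ _).le

/-- The pressure series with weights `w`, as a function of `(t, q)`. -/
noncomputable def gibbsSum (w : ℕ → ℝ) (x : ℝ × ℝ) : ℝ := ∑' j, w j * pressureTerm x.1 x.2 j

/-- The logarithmic derivative of `pressureTerm` with respect to `(t, q)`. -/
noncomputable def logPressureTerm (j : ℕ) : ℝ × ℝ →L[ℝ] ℝ :=
  (-Real.log 2) • (((j : ℝ) + 1) • ContinuousLinearMap.fst ℝ ℝ ℝ +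
    ((2 : ℝ) ^ (j + 1) - 1) • ContinuousLinearMap.snd ℝ ℝ ℝ)

theorem logPressureTerm_apply (j : ℕ) (v : ℝ × ℝ) :
    logPressureTerm j v = -Real.log 2 * (((j : ℝ) + 1) * v.1 + ((2 : ℝ) ^ (j + 1) - 1) * v.2) :=
  rfl

/-- Around any base point the pressure series is therefore a series of exponentials of linear
functionals of the displacement. -/
theorem pressureTerm_add (x v : ℝ × ℝ) (j : ℕ) :
    pressureTerm (x.1 + v.1) (x.2 + v.2) j =
      pressureTerm x.1 x.2 j * Real.exp (logPressureTerm j v) := by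
  rw [pressureTerm, pressureTerm, Real.rpow_def_of_pos two_pos, Real.rpow_def_of_pos two_pos,
    ← Real.exp_add, logPressureTerm_apply]
  congr 1
  ring

theorem norm_logPressureTerm_le (j : ℕ) :
    ‖logPressureTerm j‖ ≤ Real.log 2 * (((j : ℝ) + 1) + ((2 : ℝ) ^ (j + 1) - 1)) := by
  have h1 : (0 : ℝ) ≤ 2 ^ (j + 1) - 1 := sub_nonneg.2 (one_le_pow₀ one_le_two)
  have h2 : 0 < Real.log 2 := Real.log_pos one_lt_two
  refine ContinuousLinearMap.opNorm_le_bound _ (by positivity) fun v => ?_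
  have h3 := norm_fst_le v
  have h4 := norm_snd_le v
  rw [logPressureTerm_apply, norm_mul, norm_neg, Real.norm_of_nonneg h2.le, mul_assoc]
  gcongr
  refine (norm_add_le _ _).trans ?_
  have h5 : ‖((j : ℝ) + 1) * v.1‖ = ((j : ℝ) + 1) * ‖v.1‖ := by
    rw [norm_mul, Real.norm_of_nonneg (by positivity)]
  have h6 : ‖((2 : ℝ) ^ (j + 1) - 1) * v.2‖ = ((2 : ℝ) ^ (j + 1) - 1) * ‖v.2‖ := by
    rw [norm_mul, Real.norm_of_nonneg h1]
  rw [h5, h6]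
  exact (add_le_add (mul_le_mul_of_nonneg_left h3 (by positivity))
    (mul_le_mul_of_nonneg_left h4 h1)).trans_eq (add_mul _ _ _).symm

/-- In the sup norm the worst displacement lowers `t` and `q` equally; the radius `x.2 / 2` keeps
`q` positive, where the series still converges. -/
theorem summable_gibbs_bound {w : ℕ → ℝ} (hw : ∀ j, |w j| ≤ 4 ^ (j + 1)) {x : ℝ × ℝ}
    (hx : 0 < x.2) : Summable fun j => |w j * pressureTerm x.1 x.2 j| *
      Real.exp (x.2 / 2 * ‖logPressureTerm j‖) := by
  have hr : (0 : ℝ) < x.2 / 2 := by positivity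
  refine Summable.of_nonneg_of_le (fun j => by positivity) (fun j => ?_)
    (summable_mul_pressureTerm (w := fun j => |w j|) (by simpa using hw) (x.1 - x.2 / 2) hr)
  rw [abs_mul, abs_of_pos (pressureTerm_pos _ _ _), mul_assoc]
  have e : pressureTerm (x.1 - x.2 / 2) (x.2 / 2) j = pressureTerm x.1 x.2 j *
      Real.exp (x.2 / 2 * (Real.log 2 * (((j : ℝ) + 1) + ((2 : ℝ) ^ (j + 1) - 1)))) := by
    have := pressureTerm_add x (-(x.2 / 2), -(x.2 / 2)) j
    rw [logPressureTerm_apply] at this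
    convert this using 2 <;> ring_nf
  rw [e]
  have h1 := pressureTerm_pos x.1 x.2 j
  have h2 := norm_logPressureTerm_le j
  gcongr

theorem hasFPowerSeriesAt_gibbsSum {w : ℕ → ℝ} (hw : ∀ j, |w j| ≤ 4 ^ (j + 1)) {x : ℝ × ℝ}
    (hx : 0 < x.2) : HasFPowerSeriesAt (gibbsSum w)
      (expSumSeries (fun j => w j * pressureTerm x.1 x.2 j) logPressureTerm) x := by
  have hr : (0 : ℝ) < x.2 / 2 := by positivity
  have := (hasFPowerSeriesOnBall_tsum_mul_exp (fun j => w j * pressureTerm x.1 x.2 j)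
    logPressureTerm (r := ⟨x.2 / 2, hr.le⟩) (NNReal.coe_pos.1 hr)
    (summable_gibbs_bound hw hx)).comp_sub x
  rw [zero_add] at this
  refine this.hasFPowerSeriesAt.congr (Eventually.of_forall fun y => tsum_congr fun j => ?_)
  rw [mul_assoc, ← pressureTerm_add]
  simp

theorem analyticAt_gibbsSum {w : ℕ → ℝ} (hw : ∀ j, |w j| ≤ 4 ^ (j + 1)) {x : ℝ × ℝ}
    (hx : 0 < x.2) : AnalyticAt ℝ (gibbsSum w) x :=
  (hasFPowerSeriesAt_gibbsSum hw hx).analyticAt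

theorem fderiv_gibbsSum {w : ℕ → ℝ} (hw : ∀ j, |w j| ≤ 4 ^ (j + 1)) {x : ℝ × ℝ}
    (hx : 0 < x.2) (v : ℝ × ℝ) :
    HasSum (fun j => w j * pressureTerm x.1 x.2 j * logPressureTerm j v)
      (fderiv ℝ (gibbsSum w) x v) := by
  have h1 := (hasFPowerSeriesAt_gibbsSum hw hx).hasStrictFDerivAt.hasFDerivAt.fderiv
  have h2 := hasSum_expSumSeries (by positivity) (summable_gibbs_bound hw hx) 1 v
  rw [h1]
  have h3 : ![v] = fun _ => v := by ext i : 1; simp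
  simpa [h3] using h2

theorem abs_add_one_le_four_pow (j : ℕ) : |(j : ℝ) + 1| ≤ 4 ^ (j + 1) := by
  rw [abs_of_nonneg (by positivity)]
  exact_mod_cast (Nat.lt_pow_self (n := j + 1) (by norm_num : 1 < 4)).le

theorem abs_two_pow_sub_one_le_four_pow (j : ℕ) : |(2 : ℝ) ^ (j + 1) - 1| ≤ 4 ^ (j + 1) := by
  rw [abs_of_nonneg (sub_nonneg.2 (one_le_pow₀ one_le_two))]
  have : (2 : ℝ) ^ (j + 1) ≤ 4 ^ (j + 1) := pow_le_pow_left₀ (by norm_num) (by norm_num) _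
  linarith

theorem abs_one_le_four_pow (j : ℕ) : |(1 : ℝ)| ≤ 4 ^ (j + 1) := by
  rw [abs_one]
  exact one_le_pow₀ (by norm_num)

theorem hasSum_gibbsSum {w : ℕ → ℝ} (hw : ∀ j, |w j| ≤ 4 ^ (j + 1)) {x : ℝ × ℝ} (hx : 0 < x.2) :
    HasSum (fun j => w j * pressureTerm x.1 x.2 j) (gibbsSum w x) :=
  (summable_mul_pressureTerm hw x.1 hx).hasSum

theorem gibbsSum_one (x : ℝ × ℝ) : gibbsSum (fun _ => 1) x = ∑' j, pressureTerm x.1 x.2 j := by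
  simp [gibbsSum]

/-! ### The zero of the pressure -/

theorem tsum_pressureTerm_strictAnti {q : ℝ} (hq : 0 < q) :
    StrictAnti fun t => ∑' j, pressureTerm t q j := fun s t hst => by
  have hlt : ∀ j, pressureTerm t q j < pressureTerm s q j := fun j => by
    apply Real.rpow_lt_rpow_of_exponent_lt one_lt_two
    have : (0 : ℝ) < (j : ℝ) + 1 := by positivity
    nlinarith
  exact Summable.tsum_lt_tsum (fun j => (hlt j).le) (hlt 0) (summable_pressureTerm t hq)
    (summable_pressureTerm s hq)

theorem continuousAt_tsum_pressureTerm {x : ℝ × ℝ} (hx : 0 < x.2) :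
    ContinuousAt (fun y : ℝ × ℝ => ∑' j, pressureTerm y.1 y.2 j) x :=
  (analyticAt_gibbsSum abs_one_le_four_pow hx).continuousAt.congr
    (Eventually.of_forall gibbsSum_one)

theorem hasSum_half_pow : HasSum (fun j : ℕ => (2 : ℝ) ^ (-1 * ((j : ℝ) + 1))) 1 := by
  have h := hasSum_geometric_two' (1 : ℝ)
  refine h.congr_fun fun j => ?_
  rw [neg_one_mul, Real.rpow_neg two_pos.le, ← Nat.cast_add_one, Real.rpow_natCast, pow_succ']
  field_simp

/-- At `t = -q` the first term alone equals `1`; at `t = 1` every term is below that of `∑ 2^(-j) =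
1`. The intermediate value theorem gives the root, and the two endpoints are bounds used later. -/
theorem exists_hasSum_pressureTerm_one {q : ℝ} (hq : 0 < q) :
    ∃ t, -q < t ∧ t < 1 ∧ HasSum (pressureTerm t q) 1 := by
  have h1 : 1 < ∑' j, pressureTerm (-q) q j := by
    have e : pressureTerm (-q) q 0 = 1 := by unfold pressureTerm; norm_num
    rw [(summable_pressureTerm (-q) hq).tsum_eq_zero_add, e]
    exact lt_add_of_pos_right _
      (((summable_nat_add_iff 1).2 (summable_pressureTerm (-q) hq)).tsum_pos
        (fun j => (pressureTerm_pos _ _ _).le) 0 (pressureTerm_pos _ _ _))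
  have h2 : ∑' j, pressureTerm 1 q j < 1 := by
    refine lt_of_lt_of_eq ?_ hasSum_half_pow.tsum_eq
    have hlt : ∀ j : ℕ, pressureTerm 1 q j < (2 : ℝ) ^ (-1 * ((j : ℝ) + 1)) := fun j => by
      apply Real.rpow_lt_rpow_of_exponent_lt one_lt_two
      have : (0 : ℝ) < 2 ^ (j + 1) - 1 := sub_pos.2 (one_lt_pow₀ one_lt_two (by omega))
      nlinarith
    exact Summable.tsum_lt_tsum (fun j => (hlt j).le) (hlt 0) (summable_pressureTerm 1 hq)
      hasSum_half_pow.summable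
  have hlt : -q < 1 := (tsum_pressureTerm_strictAnti hq).lt_iff_gt.1 (h2.trans h1)
  have hcont : ContinuousOn (fun t => ∑' j, pressureTerm t q j) (Icc (-q) 1) := fun t _ =>
    (ContinuousAt.comp (f := fun t : ℝ => (t, q))
      (continuousAt_tsum_pressureTerm (x := (t, q)) hq) (by fun_prop)).continuousWithinAt
  obtain ⟨t, ht, he⟩ := intermediate_value_Ioo' hlt.le hcont ⟨h2, h1⟩
  exact ⟨t, ht.1, ht.2, he ▸ (summable_pressureTerm t hq).hasSum⟩

/-- The zero `t(q)` of the pressure `t ↦ P(t, q)`. -/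
noncomputable def pressureRoot (q : ℝ) : ℝ :=
  if hq : 0 < q then (exists_hasSum_pressureTerm_one hq).choose else 0

theorem pressureRoot_spec {q : ℝ} (hq : 0 < q) : -q < pressureRoot q ∧ pressureRoot q < 1 ∧
    HasSum (pressureTerm (pressureRoot q) q) 1 := by
  rw [pressureRoot, dif_pos hq]
  exact (exists_hasSum_pressureTerm_one hq).choose_spec

theorem lt_pressureRoot_iff {q s : ℝ} (hq : 0 < q) :
    s < pressureRoot q ↔ 1 < ∑' j, pressureTerm s q j := by
  rw [← (pressureRoot_spec hq).2.2.tsum_eq, (tsum_pressureTerm_strictAnti hq).lt_iff_gt]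

theorem pressureRoot_lt_iff {q s : ℝ} (hq : 0 < q) :
    pressureRoot q < s ↔ ∑' j, pressureTerm s q j < 1 := by
  rw [← (pressureRoot_spec hq).2.2.tsum_eq, (tsum_pressureTerm_strictAnti hq).lt_iff_gt]

theorem eq_pressureRoot_iff {q s : ℝ} (hq : 0 < q) :
    s = pressureRoot q ↔ ∑' j, pressureTerm s q j = 1 := by
  rw [← (pressureRoot_spec hq).2.2.tsum_eq, (tsum_pressureTerm_strictAnti hq).injective.eq_iff]

theorem pressure_eq_zero_iff {q s : ℝ} (hq : 0 < q) : pressure s q = 0 ↔ s = pressureRoot q := by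
  have : 0 < ∑' j, pressureTerm s q j := (summable_pressureTerm s hq).tsum_pos
    (fun j => (pressureTerm_pos _ _ _).le) 0 (pressureTerm_pos _ _ _)
  rw [eq_pressureRoot_iff hq, pressure]
  exact ⟨Real.eq_one_of_pos_of_log_eq_zero this, fun h => by rw [h, Real.log_one]⟩

/-- Monotonicity in `t` turns `s < t(q)` and `t(q) < s` into strict inequalities on the continuous
function `q ↦ ∑ j, pressureTerm s q j`, hence into open conditions on `q`. -/
theorem continuousOn_pressureRoot : ContinuousOn pressureRoot (Ioi 0) := by
  intro q hq
  have hq : 0 < q := hq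
  have hcont : ∀ s, ContinuousAt (fun q => ∑' j, pressureTerm s q j) q := fun s =>
    ContinuousAt.comp (f := fun q : ℝ => (s, q))
      (continuousAt_tsum_pressureTerm (x := (s, q)) hq) (by fun_prop)
  refine ContinuousAt.continuousWithinAt (tendsto_order.2 ⟨fun s hs => ?_, fun s hs => ?_⟩)
  · filter_upwards [(hcont s).eventually_const_lt ((lt_pressureRoot_iff hq).1 hs),
      eventually_gt_nhds hq] with r h1 h2
    exact (lt_pressureRoot_iff h2).2 h1
  · filter_upwards [(hcont s).eventually_lt_const ((pressureRoot_lt_iff hq).1 hs),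
      eventually_gt_nhds hq] with r h1 h2
    exact (pressureRoot_lt_iff h2).2 h1

/-- At `q = 0` and `s < 1` the series is geometric with sum above `1`. A finite partial sum already
exceeds `1`, and it is continuous across `q = 0`, where continuity of the full series is not
available. -/
theorem eventually_lt_pressureRoot {s : ℝ} (hs0 : 0 < s) (hs1 : s < 1) :
    ∀ᶠ q in 𝓝[>] 0, s < pressureRoot q := by
  have hsum : Summable fun j : ℕ => pressureTerm s 0 j := by
    have : ∀ j : ℕ, pressureTerm s 0 j = (2 : ℝ) ^ (-s) * ((2 : ℝ) ^ (-s)) ^ j := fun j => by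
      rw [pressureTerm, ← Real.rpow_natCast (2 ^ (-s)), ← Real.rpow_mul two_pos.le,
        ← Real.rpow_add two_pos]
      congr 1; ring
    simp_rw [this]
    exact (summable_geometric_of_lt_one (by positivity)
      (Real.rpow_lt_one_of_one_lt_of_neg one_lt_two (by linarith))).mul_left _
  have h1 : 1 < ∑' j, pressureTerm s 0 j := by
    refine lt_of_eq_of_lt hasSum_half_pow.tsum_eq.symm ?_
    have hlt : ∀ j : ℕ, (2 : ℝ) ^ (-1 * ((j : ℝ) + 1)) < pressureTerm s 0 j := fun j => by
      apply Real.rpow_lt_rpow_of_exponent_lt one_lt_two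
      have : (0 : ℝ) < (j : ℝ) + 1 := by positivity
      nlinarith
    exact Summable.tsum_lt_tsum (fun j => (hlt j).le) (hlt 0) hasSum_half_pow.summable hsum
  obtain ⟨n, hn⟩ := (hsum.hasSum.tendsto_sum_nat.eventually_const_lt h1).exists
  have hcont : Continuous fun q => ∑ j ∈ Finset.range n, pressureTerm s q j :=
    continuous_finsetSum _ fun j _ =>
      Continuous.rpow continuous_const (by fun_prop) fun _ => Or.inl (by norm_num)
  filter_upwards [nhdsWithin_le_nhds (hcont.continuousAt.eventually_const_lt hn),
    self_mem_nhdsWithin] with q h2 h3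
  have h3 : 0 < q := h3
  rw [lt_pressureRoot_iff h3]
  exact h2.trans_le ((summable_pressureTerm s h3).sum_le_tsum _
    fun j _ => (pressureTerm_pos _ _ _).le)

/-! ### Solving the critical equation -/

/-- The mean block length under the Gibbs distribution. -/
noncomputable def meanLength (x : ℝ × ℝ) : ℝ := gibbsSum (fun j => (j : ℝ) + 1) x

/-- The mean of the potential summed over a block, under the Gibbs distribution. -/
noncomputable def meanSum (x : ℝ × ℝ) : ℝ := gibbsSum (fun j => (2 : ℝ) ^ (j + 1) - 1) x

theorem one_le_meanLength {x : ℝ × ℝ} (hx : 0 < x.2) (h : HasSum (pressureTerm x.1 x.2) 1) :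
    1 ≤ meanLength x := by
  refine hasSum_le (fun j => ?_) h (hasSum_gibbsSum abs_add_one_le_four_pow hx)
  refine le_mul_of_one_le_left (pressureTerm_pos _ _ _).le ?_
  linarith [(Nat.cast_nonneg j : (0 : ℝ) ≤ j)]

theorem meanLength_pos {x : ℝ × ℝ} (hx : 0 < x.2) : 0 < meanLength x :=
  (summable_mul_pressureTerm abs_add_one_le_four_pow x.1 hx).tsum_pos
    (fun j => mul_nonneg (by positivity) (pressureTerm_pos _ _ _).le) 0
    (mul_pos (by positivity) (pressureTerm_pos _ _ _))

/-- Blocks of length one have equal sum and length, and the excess of longer blocks is suppressed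
exponentially in `q`; so the ratio of the means tends to `1` as `q → ∞`. -/
theorem meanSum_sub_meanLength_le {x : ℝ × ℝ} (hx : 2 ≤ x.2) (h : 0 ≤ x.1 + x.2) :
    meanSum x - meanLength x ≤ 2 * (2 : ℝ) ^ (2 - x.2) := by
  have hx0 : 0 < x.2 := by linarith
  have h1 := (hasSum_gibbsSum abs_two_pow_sub_one_le_four_pow hx0).sub
    (hasSum_gibbsSum abs_add_one_le_four_pow hx0)
  have h2 : HasSum (fun j : ℕ => (1 / 2 : ℝ) ^ j * (2 : ℝ) ^ (2 - x.2)) (2 * 2 ^ (2 - x.2)) :=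
    hasSum_geometric_two.mul_right _
  refine hasSum_le (fun j => ?_) h1 h2
  rw [← sub_mul]
  -- Here `d` is the excess of sum over length; `t + q ≥ 0` bounds the weight by `2^(-q d)`, and `d
  -- * 2^(-q d) ≤ 2^((1 - q) d)`.
  obtain ⟨d, hd⟩ : ∃ d : ℕ, 2 ^ (j + 1) = d + 1 + (j + 1) := by
    have := Nat.lt_pow_self (n := j + 1) one_lt_two
    exact ⟨2 ^ (j + 1) - 1 - (j + 1), by omega⟩
  have hd' : (2 : ℝ) ^ (j + 1) = d + 1 + (j + 1) := by exact_mod_cast hd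
  rcases j with _ | j
  · norm_num at hd' ⊢
    positivity
  · have hjd : j + 1 ≤ d := by
      have h3 := Nat.lt_pow_self (n := j + 1) one_lt_two
      rw [pow_succ] at hd
      omega
    have e : (2 : ℝ) ^ (j + 1 + 1) - 1 - ((j + 1 : ℕ) + 1) = d := by rw [hd']; push_cast; ring
    rw [e]
    have h4 : (d : ℝ) ≤ (2 : ℝ) ^ (d : ℝ) := by
      rw [Real.rpow_natCast]; exact_mod_cast Nat.lt_two_pow_self.le
    refine (mul_le_mul_of_nonneg_right h4 (pressureTerm_pos _ _ _).le).trans ?_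
    have e2 : (1 / 2 : ℝ) ^ (j + 1) = 2 ^ (-((j + 1 : ℕ) : ℝ)) := by
      rw [Real.rpow_neg two_pos.le, Real.rpow_natCast, one_div, inv_pow]
    rw [e2, pressureTerm, ← Real.rpow_add two_pos, ← Real.rpow_add two_pos, hd']
    apply Real.rpow_le_rpow_of_exponent_le one_le_two
    have h5 : ((j : ℝ) + 1) ≤ d := by exact_mod_cast hjd
    have h6 : (1 : ℝ) ≤ d := by exact_mod_cast (Nat.le_add_left 1 j).trans hjd
    have h7 : (0 : ℝ) ≤ (j : ℝ) := Nat.cast_nonneg j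
    push_cast
    nlinarith [mul_nonneg (sub_nonneg.2 hx) (sub_nonneg.2 h6), mul_nonneg h h7]

theorem exists_meanSum_lt {α : ℝ} (hα : 1 < α) :
    ∃ q, 0 < q ∧ meanSum (pressureRoot q, q) < α * meanLength (pressureRoot q, q) := by
  have hlim : Tendsto (fun q : ℝ => 2 * (2 : ℝ) ^ (2 - q)) atTop (𝓝 (2 * 0)) := by
    refine Tendsto.const_mul _ ((tendsto_rpow_atBot_of_base_gt_one 2 one_lt_two).comp ?_)
    exact tendsto_atBot_add_const_left _ _ tendsto_neg_atTop_atBot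
  rw [mul_zero] at hlim
  obtain ⟨q, h1, h2⟩ := ((hlim.eventually_lt_const (sub_pos.2 hα)).and
    (eventually_ge_atTop 2)).exists
  have hq : 0 < q := by linarith
  obtain ⟨h3, -, h4⟩ := pressureRoot_spec hq
  have h5 := meanSum_sub_meanLength_le (x := (pressureRoot q, q)) h2 (by simp only; linarith)
  have h6 := one_le_meanLength (x := (pressureRoot q, q)) hq h4
  refine ⟨q, hq, ?_⟩
  simp only at h5
  nlinarith

theorem meanLength_le_of_half_le {x : ℝ × ℝ} (hx : 0 < x.2) (h : 1 / 2 ≤ x.1) :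
    meanLength x ≤ ∑' j : ℕ, ((j : ℝ) + 1) * (2 : ℝ) ^ (-(1 / 2) * ((j : ℝ) + 1)) := by
  have hs : Summable fun j : ℕ => ((j : ℝ) + 1) * (2 : ℝ) ^ (-(1 / 2) * ((j : ℝ) + 1)) := by
    have h1 : ‖(2 : ℝ) ^ (-(1 / 2) : ℝ)‖ < 1 := by
      rw [Real.norm_of_nonneg (by positivity)]
      exact Real.rpow_lt_one_of_one_lt_of_neg one_lt_two (by norm_num)
    have h2 := summable_pow_mul_geometric_of_norm_lt_one 1 h1
    rw [← summable_nat_add_iff 1] at h2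
    refine h2.congr fun j => ?_
    rw [pow_one, ← Real.rpow_natCast, ← Real.rpow_mul two_pos.le, Nat.cast_add_one]
  refine Summable.tsum_le_tsum (fun j => ?_)
    (summable_mul_pressureTerm abs_add_one_le_four_pow x.1 hx) hs
  refine mul_le_mul_of_nonneg_left ?_ (by positivity)
  apply Real.rpow_le_rpow_of_exponent_le one_le_two
  have h1 : (0 : ℝ) ≤ 2 ^ (j + 1) - 1 := sub_nonneg.2 (one_le_pow₀ one_le_two)
  have h2 : (0 : ℝ) < (j : ℝ) + 1 := by positivity
  nlinarith [mul_nonneg hx.le h1]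

/-- As long as `q * 2^(j+1) ≤ 1`, the weight is at least `2^(-(j+2))` against a sum of at least
`2^j`: each such block length contributes `1/4`. Hence the mean sum blows up as `q → 0`, while the
mean length stays bounded once `t ≥ 1/2`. -/
theorem le_meanSum {x : ℝ × ℝ} (hx : 0 < x.2) (h : x.1 ≤ 1) {n : ℕ} (hn : x.2 * 2 ^ n ≤ 1) :
    (n : ℝ) / 4 ≤ meanSum x := by
  have h0 : ∀ j : ℕ, (0 : ℝ) ≤ 2 ^ (j + 1) - 1 := fun j => sub_nonneg.2 (one_le_pow₀ one_le_two)
  have h1 : ∑ j ∈ Finset.range n, (1 / 4 : ℝ) ≤ meanSum x := by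
    refine le_trans (Finset.sum_le_sum fun j hj => ?_)
      ((summable_mul_pressureTerm abs_two_pow_sub_one_le_four_pow x.1 hx).sum_le_tsum
        (Finset.range n) fun j _ => mul_nonneg (h0 j) (pressureTerm_pos _ _ _).le)
    have h2 : (2 : ℝ) ^ j ≤ 2 ^ (j + 1) - 1 := by
      have : (1 : ℝ) ≤ 2 ^ j := one_le_pow₀ one_le_two
      rw [pow_succ]; linarith
    have h3 : (2 : ℝ) ^ (j + 1) ≤ 2 ^ n :=
      pow_le_pow_right₀ one_le_two (Finset.mem_range.1 hj)
    have h4 : (2 : ℝ) ^ (-((j : ℝ) + 2)) ≤ pressureTerm x.1 x.2 j := by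
      apply Real.rpow_le_rpow_of_exponent_le one_le_two
      have h5 : (0 : ℝ) < (j : ℝ) + 1 := by positivity
      nlinarith [mul_le_mul_of_nonneg_left h3 hx.le]
    have e : (1 / 4 : ℝ) = 2 ^ j * (2 : ℝ) ^ (-((j : ℝ) + 2)) := by
      rw [← Real.rpow_natCast, ← Real.rpow_add two_pos]
      rw [show (j : ℝ) + -((j : ℝ) + 2) = -((2 : ℕ) : ℝ) by push_cast; ring,
        Real.rpow_neg two_pos.le, Real.rpow_natCast]
      norm_num
    rw [e]
    exact mul_le_mul h2 h4 (by positivity) (h0 j)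
  simpa [div_eq_mul_inv] using h1

theorem exists_lt_meanSum {α : ℝ} (hα : 1 < α) :
    ∃ q, 0 < q ∧ α * meanLength (pressureRoot q, q) < meanSum (pressureRoot q, q) := by
  set A := ∑' j : ℕ, ((j : ℝ) + 1) * (2 : ℝ) ^ (-(1 / 2) * ((j : ℝ) + 1))
  obtain ⟨n, hn⟩ := exists_nat_gt (4 * (α * A))
  have hlim : Tendsto (fun q : ℝ => q * 2 ^ n) (𝓝[>] 0) (𝓝 (0 * 2 ^ n)) :=
    (Continuous.tendsto (by fun_prop) 0).mono_left nhdsWithin_le_nhds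
  rw [zero_mul] at hlim
  obtain ⟨q, ⟨h1, h2⟩, h3⟩ := ((hlim.eventually_lt_const one_pos).and
    (eventually_lt_pressureRoot (s := 1 / 2) (by norm_num) (by norm_num))).and
    self_mem_nhdsWithin |>.exists
  have h3 : 0 < q := h3
  refine ⟨q, h3, ?_⟩
  have h4 := meanLength_le_of_half_le (x := (pressureRoot q, q)) h3 h2.le
  have h5 := le_meanSum (x := (pressureRoot q, q)) h3 (pressureRoot_spec h3).2.1.le h1.le
  have h6 := mul_le_mul_of_nonneg_left h4 (by linarith : 0 ≤ α)
  linarith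

theorem exists_meanSum_eq {α : ℝ} (hα : 1 < α) :
    ∃ q, 0 < q ∧ meanSum (pressureRoot q, q) = α * meanLength (pressureRoot q, q) := by
  obtain ⟨a, ha, h1⟩ := exists_meanSum_lt hα
  obtain ⟨b, hb, h2⟩ := exists_lt_meanSum hα
  have hcurve : ∀ w : ℕ → ℝ, (∀ j, |w j| ≤ 4 ^ (j + 1)) →
      ContinuousOn (fun q => gibbsSum w (pressureRoot q, q)) (Ioi 0) := fun w hw q hq =>
    ContinuousAt.comp_continuousWithinAt (f := fun q => (pressureRoot q, q))
      (analyticAt_gibbsSum hw (x := (pressureRoot q, q)) hq).continuousAt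
      ((continuousOn_pressureRoot q hq).prodMk continuousWithinAt_id)
  obtain ⟨q, hq, h⟩ := isPreconnected_Ioi.intermediate_value₂ (a := a) (b := b) ha hb
    (hcurve _ abs_two_pow_sub_one_le_four_pow)
    ((hcurve _ abs_add_one_le_four_pow).const_smul α) h1.le h2.le
  exact ⟨q, hq, h⟩

/-! ### The variational formula and its consequences -/

theorem birkhoffSpectrum_le {q α : ℝ} (hq : 0 < q) (hα : 1 ≤ α) :
    birkhoffSpectrum α ≤ pressureRoot q + q * α := by
  obtain ⟨h1, -, h2⟩ := pressureRoot_spec hq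
  have h3 : 0 ≤ pressureRoot q + q * α := by nlinarith
  exact ENNReal.toReal_le_of_le_ofReal h3 (dimH_birkhoffLevelSet_le h2 hq h3)

theorem birkhoffSpectrum_eq {t q α : ℝ} (hq : 0 < q) (hα : 1 ≤ α) (h : HasSum (pressureTerm t q) 1)
    (hc : meanSum (t, q) = α * meanLength (t, q)) : birkhoffSpectrum α = t + q * α := by
  have ht : t = pressureRoot q := (eq_pressureRoot_iff hq).2 h.tsum_eq
  refine le_antisymm (ht ▸ birkhoffSpectrum_le hq hα) ?_
  have h1 := le_dimH_birkhoffLevelSet h (hasSum_gibbsSum abs_add_one_le_four_pow (x := (t, q)) hq)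
    (hasSum_gibbsSum abs_two_pow_sub_one_le_four_pow (x := (t, q)) hq)
  have h2 : gibbsSum (fun j => (2 : ℝ) ^ (j + 1) - 1) (t, q) /
      gibbsSum (fun j => (j : ℝ) + 1) (t, q) = α :=
    (div_eq_iff (meanLength_pos (x := (t, q)) hq).ne').2 hc
  rw [h2] at h1
  exact (ENNReal.ofReal_le_iff_le_toReal (Real.dimH_ne_top _)).1 h1

/-- Every block longer than one has excess at least `1`, so the mean excess dominates the
probability of such blocks. -/
theorem one_sub_pressureTerm_le {x : ℝ × ℝ} (hx : 0 < x.2) (h : HasSum (pressureTerm x.1 x.2) 1) :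
    1 - pressureTerm x.1 x.2 0 ≤ meanSum x - meanLength x := by
  refine hasSum_le (fun j => ?_) (h.sub (hasSum_ite_eq 0 (pressureTerm x.1 x.2 0)))
    ((hasSum_gibbsSum abs_two_pow_sub_one_le_four_pow hx).sub
      (hasSum_gibbsSum abs_add_one_le_four_pow hx))
  rcases j with _ | j
  · norm_num
  · rw [if_neg (Nat.succ_ne_zero j), sub_zero, ← sub_mul]
    refine le_mul_of_one_le_left (pressureTerm_pos _ _ _).le ?_
    have h1 : j + 4 ≤ 2 ^ (j + 1 + 1) := by
      have := Nat.lt_pow_self (n := j) one_lt_two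
      rw [pow_succ, pow_succ]; omega
    have h2 : (j : ℝ) + 4 ≤ 2 ^ (j + 1 + 1) := by exact_mod_cast h1
    push_cast
    linarith

/-- As `q → ∞` the mean excess vanishes, so the weight `2^(-(t(q) + q))` of the shortest block tends
to `1`, that is, `t(q) + q → 0`. -/
theorem nonpos_of_le_pressureRoot_add {b : ℝ} (hb : ∀ q, 0 < q → b ≤ pressureRoot q + q) :
    b ≤ 0 := by
  by_contra! hb0
  have hlim : Tendsto (fun q : ℝ => 2 * (2 : ℝ) ^ (2 - q)) atTop (𝓝 (2 * 0)) := by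
    refine Tendsto.const_mul _ ((tendsto_rpow_atBot_of_base_gt_one 2 one_lt_two).comp ?_)
    exact tendsto_atBot_add_const_left _ _ tendsto_neg_atTop_atBot
  have h1 : (2 : ℝ) ^ (-b) < 1 := Real.rpow_lt_one_of_one_lt_of_neg one_lt_two (by linarith)
  have h2 : 1 - (2 : ℝ) ^ (-b) ≤ 2 * 0 := by
    refine ge_of_tendsto hlim ?_
    filter_upwards [eventually_ge_atTop 2] with q hq2
    have hq : 0 < q := by linarith
    obtain ⟨h3, -, h4⟩ := pressureRoot_spec hq
    have h5 := meanSum_sub_meanLength_le (x := (pressureRoot q, q)) hq2 (by simp only; linarith)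
    have h6 := one_sub_pressureTerm_le (x := (pressureRoot q, q)) hq h4
    have h7 : pressureTerm (pressureRoot q) q 0 ≤ 2 ^ (-b) := by
      apply Real.rpow_le_rpow_of_exponent_le one_le_two
      have := hb q hq
      norm_num
      linarith
    simp only at h5 h6
    linarith
  linarith

theorem isGLB_birkhoffSpectrum {α : ℝ} (hα : 1 ≤ α) :
    IsGLB ((fun q : ℝ => pressureRoot q + q * α) '' Ioi 0) (birkhoffSpectrum α) := by
  refine ⟨?_, fun b hb => ?_⟩
  · rintro _ ⟨q, hq, rfl⟩
    exact birkhoffSpectrum_le hq hα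
  -- For `α = 1` the infimum is only approached as `q → ∞`, since `t(q) > -q`; for `α > 1` it is
  -- attained at the critical `q`.
  rcases hα.eq_or_lt with rfl | hα
  · refine (nonpos_of_le_pressureRoot_add fun q hq => ?_).trans ENNReal.toReal_nonneg
    simpa using hb ⟨q, hq, rfl⟩
  · obtain ⟨q, hq, h⟩ := exists_meanSum_eq hα
    rw [birkhoffSpectrum_eq hq hα.le (pressureRoot_spec hq).2.2 h]
    exact hb ⟨q, hq, rfl⟩

theorem birkhoffSpectrum_le_one (α : ℝ) : birkhoffSpectrum α ≤ 1 := by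
  have := dimH_mono (subset_univ (birkhoffLevelSet α))
  rw [Real.dimH_univ] at this
  exact ENNReal.toReal_le_of_le_ofReal one_pos.le (by simpa using this)

/-- The `q > 0` that is critical for the larger argument `β` gives an upper bound at `α` which is
smaller by `q (β - α)`. -/
theorem strictMonoOn_birkhoffSpectrum : StrictMonoOn birkhoffSpectrum (Ici 1) := by
  intro α hα β hβ hαβ
  have hα : 1 ≤ α := hα
  have hβ : 1 < β := hα.trans_lt hαβ
  obtain ⟨q, hq, h⟩ := exists_meanSum_eq hβ
  rw [birkhoffSpectrum_eq hq hβ.le (pressureRoot_spec hq).2.2 h]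
  refine (birkhoffSpectrum_le hq hα).trans_lt ?_
  nlinarith

theorem concaveOn_birkhoffSpectrum : ConcaveOn ℝ (Ici 1) birkhoffSpectrum := by
  refine ⟨convex_Ici 1, fun α hα β hβ a b ha hb hab => ?_⟩
  refine (isGLB_birkhoffSpectrum (convex_Ici 1 hα hβ ha hb hab)).2 ?_
  rintro _ ⟨q, hq, rfl⟩
  have h1 := mul_le_mul_of_nonneg_left (birkhoffSpectrum_le hq hα) ha
  have h2 := mul_le_mul_of_nonneg_left (birkhoffSpectrum_le hq hβ) hb
  have h3 : (a + b) * pressureRoot q = pressureRoot q := by rw [hab, one_mul]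
  simp only [smul_eq_mul]
  nlinarith

theorem tendsto_birkhoffSpectrum : Tendsto birkhoffSpectrum atTop (𝓝 1) := by
  refine tendsto_order.2 ⟨fun s hs => ?_, fun s hs =>
    Eventually.of_forall fun α => (birkhoffSpectrum_le_one α).trans_lt hs⟩
  obtain ⟨r, hr, hr1⟩ := exists_between (max_lt hs one_pos)
  obtain ⟨hsr, hr0⟩ := max_lt_iff.1 hr
  obtain ⟨δ, hδ, h⟩ := mem_nhdsGT_iff_exists_Ioo_subset.1 (eventually_lt_pressureRoot hr0 hr1)
  have hδ : 0 < δ := hδ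
  -- For `q < δ` the root alone exceeds `r`; for `q ≥ δ`, `t(q) > -q` gives `t(q) + q α > q (α - 1)
  -- ≥ 1`.
  filter_upwards [eventually_ge_atTop (1 + 1 / δ)] with α hα
  have hα1 : 1 ≤ α := by linarith [one_div_pos.2 hδ]
  refine hsr.trans_le ((isGLB_birkhoffSpectrum hα1).2 ?_)
  rintro _ ⟨q, hq, rfl⟩
  have hq : 0 < q := hq
  rcases lt_or_ge q δ with hqδ | hqδ
  · have : r < pressureRoot q := h ⟨hq, hqδ⟩
    simp only
    nlinarith
  · have h1 := (pressureRoot_spec hq).1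
    have h2 : 1 / δ ≤ α - 1 := by linarith
    rw [div_le_iff₀ hδ] at h2
    simp only
    nlinarith [mul_le_mul_of_nonneg_right hqδ (sub_nonneg.2 hα1)]

/-! ### Nondegeneracy and real-analyticity -/

/-- Strict convexity of the pressure: the map `(t, q) ↦ (∑ p, B / A)`, `p` the Gibbs weights and
`A`, `B` the mean length and sum, has injective derivative at its critical points. -/
theorem eq_zero_of_fderiv_eq_zero {x v : ℝ × ℝ} {α : ℝ} (hx : 0 < x.2) (hα : 1 < α)
    (hc : meanSum x = α * meanLength x)
    (h1 : fderiv ℝ (gibbsSum fun _ => 1) x v = 0)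
    (h2 : fderiv ℝ meanSum x v = α * fderiv ℝ meanLength x v) : v = 0 := by
  have hlog : Real.log 2 ≠ 0 := (Real.log_pos one_lt_two).ne'
  have hl := hasSum_gibbsSum abs_add_one_le_four_pow hx
  have hs := hasSum_gibbsSum abs_two_pow_sub_one_le_four_pow hx
  have hd1 := fderiv_gibbsSum abs_one_le_four_pow hx v
  have hdl := fderiv_gibbsSum abs_add_one_le_four_pow hx v
  have hds := fderiv_gibbsSum abs_two_pow_sub_one_le_four_pow hx v
  -- Constancy of the total mass forces `v` to be proportional to `(-α, 1)`.
  have hv : v.1 = -(α * v.2) := by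
    have h3 := ((hl.mul_left v.1).add (hs.mul_left v.2)).mul_left (-Real.log 2)
    have h4 : HasSum (fun j => 1 * pressureTerm x.1 x.2 j * logPressureTerm j v)
        (-Real.log 2 * (v.1 * meanLength x + v.2 * meanSum x)) := by
      refine h3.congr_fun fun j => ?_
      rw [logPressureTerm_apply]; ring
    have h5 := hd1.unique h4
    rw [h1, hc] at h5
    have h6 : meanLength x * (v.1 + α * v.2) = 0 := by
      rcases mul_eq_zero.1 h5.symm with h | h
      · exact absurd (neg_eq_zero.1 h) hlog
      · linarith
    rcases mul_eq_zero.1 h6 with h | h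
    · exact absurd h (meanLength_pos hx).ne'
    · linarith
  have hsq : HasSum (fun j : ℕ => (-Real.log 2 * v.2) *
      (((2 : ℝ) ^ (j + 1) - 1 - α * ((j : ℝ) + 1)) ^ 2 * pressureTerm x.1 x.2 j)) 0 := by
    have h3 := hds.sub (hdl.mul_left α)
    have h4 : fderiv ℝ (gibbsSum fun j => (2 : ℝ) ^ (j + 1) - 1) x v -
        α * fderiv ℝ (gibbsSum fun j => (j : ℝ) + 1) x v = 0 := sub_eq_zero.2 h2
    rw [h4] at h3
    refine h3.congr_fun fun j => ?_
    rw [logPressureTerm_apply, hv]; ring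
  have hv2 : v.2 = 0 := by
    by_contra hne
    have hk : -Real.log 2 * v.2 ≠ 0 := mul_ne_zero (neg_ne_zero.2 hlog) hne
    have h3 := hsq.mul_left (-Real.log 2 * v.2)⁻¹
    rw [mul_zero] at h3
    have h4 := h3.congr_fun (g := fun j : ℕ =>
      ((2 : ℝ) ^ (j + 1) - 1 - α * ((j : ℝ) + 1)) ^ 2 * pressureTerm x.1 x.2 j)
      fun j => (inv_mul_cancel_left₀ hk _).symm
    have h5 := (hasSum_zero_iff_of_nonneg fun j =>
      mul_nonneg (sq_nonneg _) (pressureTerm_pos x.1 x.2 j).le).1 h4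
    -- The shortest block gives the term `(1 - α)^2` times a positive weight, nonzero because `α >
    -- 1`.
    have h6 := congrFun h5 0
    simp only [Pi.zero_apply, mul_eq_zero, (pressureTerm_pos x.1 x.2 0).ne', or_false] at h6
    norm_num at h6
    linarith
  rw [hv2, mul_zero, neg_zero] at hv
  exact Prod.ext hv hv2

theorem AnalyticAt.exists_analyticAt_rightInverse {E : Type*} [NormedAddCommGroup E]
    [NormedSpace ℝ E] [FiniteDimensional ℝ E] {f : E → E} {x : E} (hf : AnalyticAt ℝ f x)
    (hinj : Function.Injective (fderiv ℝ f x)) :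
    ∃ g : E → E, AnalyticAt ℝ g (f x) ∧ g (f x) = x ∧ ∀ᶠ y in 𝓝 (f x), f (g y) = y := by
  have : CompleteSpace E := FiniteDimensional.complete ℝ E
  let e : E ≃L[ℝ] E :=
    (LinearEquiv.ofInjectiveEndo (fderiv ℝ f x : E →ₗ[ℝ] E) hinj).toContinuousLinearEquiv
  have he : (e : E →L[ℝ] E) = fderiv ℝ f x := ContinuousLinearMap.ext fun _ => rfl
  have hfe : HasFDerivAt f (e : E →L[ℝ] E) x := he ▸ hf.differentiableAt.hasFDerivAt
  -- The exponent `⊤` denotes analytic regularity, which the local inverse inherits.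
  have hcd : ContDiffAt ℝ ⊤ f x := hf.contDiffAt
  exact ⟨hcd.localInverse hfe (by simp), (hcd.to_localInverse hfe (by simp)).analyticAt,
    hcd.localInverse_apply_image hfe (by simp),
    (hcd.hasStrictFDerivAt' hfe (by simp)).eventually_right_inverse⟩

/-- The total mass of the Gibbs weights together with the ratio of the means. -/
noncomputable def gibbsMap (x : ℝ × ℝ) : ℝ × ℝ :=
  (gibbsSum (fun _ => 1) x, meanSum x / meanLength x)

theorem analyticAt_ratio {x : ℝ × ℝ} (hx : 0 < x.2) :
    AnalyticAt ℝ (fun y => meanSum y / meanLength y) x :=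
  (analyticAt_gibbsSum abs_two_pow_sub_one_le_four_pow hx).div
    (analyticAt_gibbsSum abs_add_one_le_four_pow hx) (meanLength_pos hx).ne'

theorem analyticAt_gibbsMap {x : ℝ × ℝ} (hx : 0 < x.2) : AnalyticAt ℝ gibbsMap x :=
  (analyticAt_gibbsSum abs_one_le_four_pow hx).prod (analyticAt_ratio hx)

theorem injective_fderiv_gibbsMap {x : ℝ × ℝ} {α : ℝ} (hx : 0 < x.2) (hα : 1 < α)
    (hc : meanSum x = α * meanLength x) : Function.Injective (fderiv ℝ gibbsMap x) := by
  have hA : DifferentiableAt ℝ meanLength x :=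
    (analyticAt_gibbsSum abs_add_one_le_four_pow hx).differentiableAt
  have hG : DifferentiableAt ℝ (gibbsSum fun _ => 1) x :=
    (analyticAt_gibbsSum abs_one_le_four_pow hx).differentiableAt
  have hR := (analyticAt_ratio hx).differentiableAt
  have hRx : meanSum x / meanLength x = α := (div_eq_iff (meanLength_pos hx).ne').2 hc
  have hd : fderiv ℝ gibbsMap x = (fderiv ℝ (gibbsSum fun _ => 1) x).prod
      (fderiv ℝ (fun y => meanSum y / meanLength y) x) :=
    (hG.hasFDerivAt.prodMk hR.hasFDerivAt).fderiv
  -- The product rule for `meanSum = (meanSum / meanLength) * meanLength` shows that a direction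
  -- killing the ratio satisfies `dB = α dA`.
  have hB' : fderiv ℝ meanSum x = α • fderiv ℝ meanLength x +
      meanLength x • fderiv ℝ (fun y => meanSum y / meanLength y) x := by
    have h1 := hR.hasFDerivAt.mul hA.hasFDerivAt
    have h2 : (fun y => meanSum y / meanLength y * meanLength y) =ᶠ[𝓝 x] meanSum := by
      filter_upwards [continuousAt_snd.eventually_const_lt hx] with y hy
      exact div_mul_cancel₀ _ (meanLength_pos hy).ne'
    rw [hRx] at h1
    exact (h1.congr_of_eventuallyEq h2.symm).fderiv
  rw [injective_iff_map_eq_zero]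
  intro v hv
  rw [hd] at hv
  have h1 : fderiv ℝ (gibbsSum fun _ => 1) x v = 0 := congrArg Prod.fst hv
  have h2 : fderiv ℝ (fun y => meanSum y / meanLength y) x v = 0 := congrArg Prod.snd hv
  refine eq_zero_of_fderiv_eq_zero hx hα hc h1 ?_
  rw [hB', add_apply, smul_apply, smul_apply, h2, smul_zero, add_zero, smul_eq_mul]

/-- The local inverse of `gibbsMap` along `β ↦ (1, β)` yields pairs `(t, q)` depending analytically
on `β` and critical for it; the spectrum near `α` is then `t + q β`. -/
theorem analyticOnNhd_birkhoffSpectrum : AnalyticOnNhd ℝ birkhoffSpectrum (Ioi 1) := by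
  intro α hα
  have hα : 1 < α := hα
  obtain ⟨q, hq, hc⟩ := exists_meanSum_eq hα
  have hx : 0 < (pressureRoot q, q).2 := hq
  have himage : gibbsMap (pressureRoot q, q) = (1, α) := by
    rw [gibbsMap, gibbsSum_one, (pressureRoot_spec hq).2.2.tsum_eq,
      (div_eq_iff (meanLength_pos hx).ne').2 hc]
  obtain ⟨g, hg, hleft, hright⟩ := (analyticAt_gibbsMap hx).exists_analyticAt_rightInverse
    (injective_fderiv_gibbsMap hx hα hc)
  rw [himage] at hg hleft hright
  have hga : AnalyticAt ℝ (fun β : ℝ => g (1, β)) α :=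
    hg.comp (f := fun β : ℝ => ((1 : ℝ), β)) (analyticAt_const.prod analyticAt_id)
  have hfst : AnalyticAt ℝ (fun β : ℝ => (g (1, β)).1) α := analyticAt_fst.comp hga
  have hsnd : AnalyticAt ℝ (fun β : ℝ => (g (1, β)).2) α := analyticAt_snd.comp hga
  have hsum : AnalyticAt ℝ (fun β : ℝ => (g (1, β)).1 + (g (1, β)).2 * β) α :=
    hfst.add (hsnd.mul analyticAt_id)
  refine hsum.congr ?_
  have hpos : 0 < (g (1, α)).2 := by rw [hleft]; exact hq
  have hcurve : ContinuousAt (fun β : ℝ => ((1 : ℝ), β)) α := by fun_prop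
  filter_upwards [hcurve.eventually hright, hsnd.continuousAt.eventually_const_lt hpos,
    eventually_gt_nhds hα] with β h1 h2 h3
  have h4 : gibbsSum (fun _ => 1) (g (1, β)) = 1 := congrArg Prod.fst h1
  have h5 : meanSum (g (1, β)) / meanLength (g (1, β)) = β := congrArg Prod.snd h1
  rw [gibbsSum_one] at h4
  symm
  refine birkhoffSpectrum_eq h2 h3.le ?_ ((div_eq_iff (meanLength_pos h2).ne').1 h5)
  exact (summable_pressureTerm _ h2).hasSum_iff.2 h4

theorem dimH_birkhoffLevelSet_one : dimH (birkhoffLevelSet 1) = 0 := by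
  have h1 : birkhoffSpectrum 1 ≤ 0 := nonpos_of_le_pressureRoot_add fun q hq => by
    simpa using birkhoffSpectrum_le hq le_rfl
  have h2 : birkhoffSpectrum 1 = 0 := le_antisymm h1 ENNReal.toReal_nonneg
  exact ((ENNReal.toReal_eq_zero_iff _).1 h2).resolve_right (Real.dimH_ne_top _)

theorem theorem1 :
    (∀ s q : ℝ, 0 < q → Summable (pressureTerm s q)) ∧
    ∃ t : ℝ → ℝ,
      (∀ q : ℝ, 0 < q → ∀ s : ℝ, pressure s q = 0 ↔ s = t q) ∧
      (∀ α : ℝ, 1 ≤ α →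
        dimH (birkhoffLevelSet α) ≠ ⊤ ∧
        IsGLB ((fun q : ℝ => t q + q * α) '' Ioi 0) (birkhoffSpectrum α)) ∧
      dimH (birkhoffLevelSet 1) = 0 ∧
      AnalyticOnNhd ℝ birkhoffSpectrum (Ioi 1) ∧
      StrictMonoOn birkhoffSpectrum (Ici 1) ∧
      ConcaveOn ℝ (Ici 1) birkhoffSpectrum ∧
      Tendsto birkhoffSpectrum atTop (𝓝 1) :=
  ⟨fun s _ hq => summable_pressureTerm s hq, pressureRoot,
    fun _ hq _ => pressure_eq_zero_iff hq,
    fun _ hα => ⟨Real.dimH_ne_top _, isGLB_birkhoffSpectrum hα⟩,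
    dimH_birkhoffLevelSet_one, analyticOnNhd_birkhoffSpectrum, strictMonoOn_birkhoffSpectrum,
    concaveOn_birkhoffSpectrum, tendsto_birkhoffSpectrum⟩
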